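/- **Setting.** There are $m$ items and one buyer, additive or unit-demand, whose value for item $i$ alone is $v_i$; write $v\in\mathbb R^m$. Producing a bundle $S\subseteq[m]$ costs $c(S)$, where $c$ is an arbitrary real-valued function. A length-$\ell$ lottery menu $M$ consists of lotteries $(\phi^{(0)},p^{(0)})=(0,0)$ and $(\phi^{(1)},p^{(1)}),\dots,(\phi^{(\ell)},p^{(\ell)})$ with $\phi^{(j)}\in[0,1]^m$ and $p^{(j)}\in\mathbb R$; if the buyer is unit-demand, also $\sum_i\phi^{(j)}_i\le 1$. The menu is thus described by a parameter vector in a set $\mathcal P\subseteq\mathbb R^{\ell(m+1)}$. The buyer chooses a lottery $(\phi_v,p_v)\in M$ that maximizes her expected utility $\sum_i v_i\phi^{(j)}_i-p^{(j)}$; ties are broken by a priority order on the menu entries, which may depend on the menu in any way. For $z\in[0,1]^m$ put $$\mathrm{profit}'_M(v,z)=p_v-c(\{i: z_i<\phi_{v,i}\}),\qquad \mathrm{profit}_M(v)=p_v-\mathbb E_q[c(q)],$$ where $q$ contains each item $i$ independently with probability $\phi_{v,i}$, and let $\mathcal M'$ be the class of all functions $\mathrm{profit}'_M$. A class of functions $f_p$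 with parameters $p\in\mathcal P\subseteq\mathbb R^d$ is $(d,t)$-delineable on a set $\mathcal Y$ if for each $y\in\mathcal Y$ there are at most $t$ hyperplanes of $\mathbb R^d$ such that $p\mapsto f_p(y)$ is of the form $a\cdot p+b$ on each connected component of $\mathcal P$ minus these hyperplanes. The pseudo-dimension $\mathrm{Pdim}$ of a class on $\mathcal Y$ is the supremum of the sizes of the finite sets $S\subseteq\mathcal Y$ for which there are thresholds $(r_y)_{y\in S}$ such that for every $T\subseteq S$ some $f$ in the class satisfies $f(y)\ge r_y\iff y\in T$ for all $y\in S$. **Theorem.** 1. For additive and for unit-demand buyers and every set $\mathcal X\subseteq\mathbb R^m$ of values, $\mathcal M'$ is $(\ell(m+1),(\ell+1)^2+m\ell)$-delineable on $\mathcal X\times[0,1]^m$. 2. There is an absolute constant $C>0$ with the following property. Let $\mathcal D$ be a probability distribution on $\mathbb R^m$ with support $\mathcal X$, and let $U$ be such that, for each menu $M$, any two values of $\mathrm{profit}'_M$ on $\mathcal X\times[0,1]^m$ differ by at most $U$. Let $\mathrm{Pdim}(\mathcal M')$ be the pseudo-dimension of $\mathcal M'$ on $\mathcal X\times[0,1]^m$,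 assumed finite. Then for all $N\ge1$ and $\delta\in(0,1)$, with probability at least $1-\delta$ over the draw of a sample $(v^{(1)},z^{(1)}),\dots,(v^{(N)},z^{(N)})$ from $(\mathcal D\times U([0,1]^m))^N$, all length-$\ell$ lottery menus $M$ satisfy $$\Big|\frac1N\sum_{i=1}^N\mathrm{profit}'_M(v^{(i)},z^{(i)})-\mathbb E_{v\sim\mathcal D}[\mathrm{profit}_M(v)]\Big|\le C\left(U\sqrt{\frac{\mathrm{Pdim}(\mathcal M')}{N}}+U\sqrt{\frac{\log(1/\delta)}{N}}\right).$$ If the buyer is unit-demand and $c$ is additive, $c(S)=\sum_{i\in S}c(\{i\})$, then on the same event the same bound holds with $\mathrm{profit}_M(v)$ replaced by the expected profit when at most one item is allocated, item $i$ with probability $\phi_{v,i}$. -/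

import Mathlib

open MeasureTheory Set
open scoped BigOperators

noncomputable section

/-! ### Delineable families and pseudo-dimension -/

/-- An affine hyperplane of `ℝ^d`. -/
def IsHyperplane {d : ℕ} (H : Set (Fin d → ℝ)) : Prop :=
  ∃ a : Fin d → ℝ, a ≠ 0 ∧ ∃ b : ℝ, H = {p | ∑ i, a i * p i = b}

/-- `g` is linear over `A`: it agrees there with `p ↦ a · p + b` for one weight vector `a` and
one offset `b`. -/
def LinearOver {d : ℕ} (g : (Fin d → ℝ) → ℝ) (A : Set (Fin d → ℝ)) : Prop :=
  ∃ (a : Fin d → ℝ) (b : ℝ), ∀ p ∈ A, g p = ∑ i, a i * p i + b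

/-- The family `(f p)`, with parameters `p` in `P ⊆ ℝ^d`, of functions on `X` is
`(d, t)`-delineable: for each `x ∈ X` there are (at most) `t` hyperplanes such that `p ↦ f p x`
is linear over every connected component of `P` minus these hyperplanes. -/
def IsDelineable {α : Type*} (d t : ℕ) (P : Set (Fin d → ℝ)) (f : (Fin d → ℝ) → α → ℝ)
    (X : Set α) : Prop :=
  ∀ x ∈ X, ∃ 𝓗 : Finset (Set (Fin d → ℝ)), 𝓗.card ≤ t ∧ (∀ H ∈ 𝓗, IsHyperplane H) ∧
    ∀ p ∈ P \ ⋃ H ∈ 𝓗, H,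
      LinearOver (fun q => f q x) (connectedComponentIn (P \ ⋃ H ∈ 𝓗, H) p)

/-- The finite set `S` is shattered by the real-valued functions in `F`, with witnesses `r`. -/
def PseudoShatters {α : Type*} (F : Set (α → ℝ)) (S : Finset α) : Prop :=
  ∃ r : α → ℝ, ∀ T ⊆ S, ∃ f ∈ F, ∀ x ∈ S, r x ≤ f x ↔ x ∈ T

/-- The pseudo-dimension of `F`, as a class of functions on `X`. -/
def pseudoDim {α : Type*} (F : Set (α → ℝ)) (X : Set α) : ℕ∞ :=
  ⨆ (S : Finset α) (_ : (S : Set α) ⊆ X ∧ PseudoShatters F S), (S.card : ℕ∞)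

/-! ### Lottery menus -/

/-- The two kinds of buyers. -/
inductive BuyerType
  | additive
  | unitDemand

/-- The `ℓ` entries of a length-`ℓ` lottery menu over `m` items that the seller sets. -/
structure LotteryMenu (m ℓ : ℕ) where
  /-- the probability that lottery `j` gives item `i` -/
  prob : Fin ℓ → Fin m → ℝ
  /-- the price of lottery `j` -/
  price : Fin ℓ → ℝ

namespace LotteryMenu

variable {m ℓ : ℕ}

/-- The menu with a given parameter vector in `ℝ^(ℓ(m+1))`: the `m + 1` coordinates of block `j`
are the `m` probabilities of lottery `j`, followed by its price. -/
def ofVector (x : Fin (ℓ * (m + 1)) → ℝ) : LotteryMenu m ℓ where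
  prob j i := x (finProdFinEquiv (j, i.castSucc))
  price j := x (finProdFinEquiv (j, Fin.last m))

/-- The parameters are probabilities; a unit-demand buyer receives at most one item, so that for
her the probabilities of a lottery sum to at most one. -/
def Valid (b : BuyerType) (M : LotteryMenu m ℓ) : Prop :=
  (∀ j i, 0 ≤ M.prob j i ∧ M.prob j i ≤ 1) ∧
    (b = BuyerType.unitDemand → ∀ j, ∑ i, M.prob j i ≤ 1)

/-- The allocation probabilities of all `ℓ + 1` menu entries; entry `0` gives nothing. -/
def φ (M : LotteryMenu m ℓ) : Fin (ℓ + 1) → Fin m → ℝ :=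
  Fin.cons 0 M.prob

/-- The prices of all `ℓ + 1` menu entries; entry `0` is free. -/
def p (M : LotteryMenu m ℓ) : Fin (ℓ + 1) → ℝ :=
  Fin.cons 0 M.price

/-- The expected utility of menu entry `j` for a buyer whose value for item `i` alone is `v i`
(the same expression for an additive and for a unit-demand buyer). -/
def utility (M : LotteryMenu m ℓ) (v : Fin m → ℝ) (j : Fin (ℓ + 1)) : ℝ :=
  ∑ i, v i * M.φ j i - M.p j

/-- The menu entries that maximize the buyer's expected utility. -/
def best (M : LotteryMenu m ℓ) (v : Fin m → ℝ) : Finset (Fin (ℓ + 1)) :=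
  open Classical in Finset.univ.filter fun j => ∀ k, M.utility v k ≤ M.utility v j

theorem best_nonempty (M : LotteryMenu m ℓ) (v : Fin m → ℝ) : (M.best v).Nonempty := by
  classical
  obtain ⟨j, -, hj⟩ := Finset.exists_max_image Finset.univ (M.utility v) Finset.univ_nonempty
  exact ⟨j, by simpa [best] using fun k => hj k (Finset.mem_univ k)⟩

/-- The entry that the buyer chooses: a maximizer of her expected utility. Ties are broken by a
priority order on the entries, where entry `j` has rank `τ M j` and the smallest rank wins. The
order may depend on the menu in any way. -/
def choice (τ : LotteryMenu m ℓ → Equiv.Perm (Fin (ℓ + 1))) (M : LotteryMenu m ℓ)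
    (v : Fin m → ℝ) : Fin (ℓ + 1) :=
  (τ M).symm (((M.best v).image (τ M)).min' ((M.best_nonempty v).image _))

/-- The bundle of the items `i` with `z i < φ i`. -/
def bundle (φ z : Fin m → ℝ) : Finset (Fin m) :=
  open Classical in Finset.univ.filter fun i => z i < φ i

/-- The derandomized profit at values `v` and thresholds `z`, with `c S` the cost of the
bundle `S`. -/
def profit' (c : Finset (Fin m) → ℝ) (τ : LotteryMenu m ℓ → Equiv.Perm (Fin (ℓ + 1)))
    (M : LotteryMenu m ℓ) (v z : Fin m → ℝ) : ℝ :=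
  M.p (M.choice τ v) - c (bundle (M.φ (M.choice τ v)) z)

/-- The expected profit at values `v`, when item `i` is allocated with probability `φ i`,
independently of the other items. -/
def profit (c : Finset (Fin m) → ℝ) (τ : LotteryMenu m ℓ → Equiv.Perm (Fin (ℓ + 1)))
    (M : LotteryMenu m ℓ) (v : Fin m → ℝ) : ℝ :=
  M.p (M.choice τ v) - ∑ S : Finset (Fin m),
    ((∏ i ∈ S, M.φ (M.choice τ v) i) * ∏ i ∈ Sᶜ, (1 - M.φ (M.choice τ v) i)) * c S

/-- The expected profit at values `v`, when at most one item is allocated: item `i` with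
probability `φ i`, and nothing with the remaining probability. -/
def singleItemProfit (c : Finset (Fin m) → ℝ)
    (τ : LotteryMenu m ℓ → Equiv.Perm (Fin (ℓ + 1))) (M : LotteryMenu m ℓ)
    (v : Fin m → ℝ) : ℝ :=
  M.p (M.choice τ v) - (∑ i, M.φ (M.choice τ v) i * c {i} +
    (1 - ∑ i, M.φ (M.choice τ v) i) * c ∅)

/-- The class of all derandomized profit functions `(v, z) ↦ profit' v z`. -/
def profitClass (b : BuyerType) (c : Finset (Fin m) → ℝ)
    (τ : LotteryMenu m ℓ → Equiv.Perm (Fin (ℓ + 1))) :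
    Set ((Fin m → ℝ) × (Fin m → ℝ) → ℝ) :=
  {f | ∃ M : LotteryMenu m ℓ, M.Valid b ∧ f = fun x => M.profit' c τ x.1 x.2}

/-- The average of the derandomized profit over a sample. -/
def empiricalProfit (c : Finset (Fin m) → ℝ)
    (τ : LotteryMenu m ℓ → Equiv.Perm (Fin (ℓ + 1))) (M : LotteryMenu m ℓ) {N : ℕ}
    (s : Fin N → (Fin m → ℝ) × (Fin m → ℝ)) : ℝ :=
  (1 / (N : ℝ)) * ∑ i, M.profit' c τ (s i).1 (s i).2

end LotteryMenu

/-- The uniform distribution on `[0,1]^m`. -/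
def uniformCube (m : ℕ) : Measure (Fin m → ℝ) :=
  volume.restrict (Icc 0 1)

/-- The cost of a bundle is the sum of the costs of its items. -/
def AdditiveCost {m : ℕ} (c : Finset (Fin m) → ℝ) : Prop :=
  ∀ S, c S = ∑ i ∈ S, c {i}

end

noncomputable section

open Filter Topology

/-! ### Pseudo-shattering and packing numbers -/

/-! Delineability. Fix `(v, z)`. The chosen entry changes only across the hyperplanes where two
entries have equal utility, and the bundle only across the hyperplanes where a probability equals
some `z i`. On a component of the complement both are constant, so the profit is one price
coordinate minus a fixed cost.

Uniform convergence. Since the coordinates of `z` are independent and uniform, `z i < φ i` are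
independent events of probability `φ i`, so averaging over `z` turns `profit'` into `profit`
(`integral_profit'`). It remains to bound the deviation of `profit'` over the class at the rate `√(d
/ N)`, without a logarithm. Symmetrization reduces this to random signs on a fixed double sample.
There Dudley chaining applies, because a class of pseudo-dimension `d` has only `(8 / e) ^ (2 * d)`
members that are `e`-separated in `L¹` (`log_card_le_of_separated`): random thresholds turn
separated functions into distinct sets, and Sauer–Shelah counts these sets.

Two obstacles are specific to menus. First, chaining needs values in `[0,1]`, while each profit
function has range of length `U` at a location of its own, and subtracting arbitrary constants may
raise the pseudo-dimension. If entry `0` is chosen somewhere, the profit there is `-c ∅`, so one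
common constant serves all such menus. If entry `0` is never chosen, subtracting `a ≥ 0` from the
profit amounts to lowering every price by `a`, which stays within the class. The menus are split
into these two kinds.

Second, ties are broken arbitrarily menu by menu, so a modified menu may choose differently. Price
bonuses of order `1 / (k + 1)` following the original priority order make the choice strict, and the
desired function is a pointwise limit of profits of such menus (`IsPerturbation.tendsto_profit'`).
Limits shatter nothing new (`PseudoShatters.of_tendsto`). The same perturbation with rational
parameters reduces all menus to countably many, which settles measurability. -/

/-- A set of indices shattered by the pulled-back class comes from an equally large set of points
that the class shatters. -/
theorem PseudoShatters.exists_of_comp {α κ : Type*} (F : Set (α → ℝ)) (x : κ → α) {S : Finset κ}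
    (h : PseudoShatters ((fun f => f ∘ x) '' F) S) :
    ∃ S' : Finset α, S'.card = S.card ∧ (S' : Set α) ⊆ Set.range x ∧ PseudoShatters F S' := by
  classical
  obtain ⟨r, hr⟩ := h
  have hinj : Set.InjOn x (S : Set κ) := by
    -- Repeated points cannot be shattered: if `x j = x k`, a function reaching the higher threshold
    -- `r k` also reaches `r j`, so the pattern `{k}` contains `j`.
    have key : ∀ j ∈ S, ∀ k ∈ S, x j = x k → r j ≤ r k → j = k := by
      intro j hj k hk hx hle
      obtain ⟨_, ⟨f, -, rfl⟩, hf⟩ := hr {k} (by simpa using hk)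
      have h1 : r k ≤ f (x k) := (hf k hk).2 (by simp)
      have h2 := (hf j hj).1 (by simpa [hx] using hle.trans h1)
      simpa using h2
    intro j hj k hk hx
    rcases le_total (r j) (r k) with h | h
    · exact key j hj k hk hx h
    · exact (key k hk j hj hx.symm h).symm
  refine ⟨S.image x, Finset.card_image_of_injOn hinj, by simp, ?_⟩
  rcases S.eq_empty_or_nonempty with rfl | ⟨j₀, hj₀⟩
  · obtain ⟨_, ⟨f, hf, rfl⟩, -⟩ := hr ∅ (by simp)
    exact ⟨0, fun T _ => ⟨f, hf, by simp⟩⟩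
  have : Nonempty κ := ⟨j₀⟩
  refine ⟨fun y => r (Function.invFunOn x S y), fun T _ => ?_⟩
  obtain ⟨_, ⟨f, hf, rfl⟩, hfr⟩ := hr (S.filter fun j => x j ∈ T) (Finset.filter_subset _ _)
  refine ⟨f, hf, fun y hy => ?_⟩
  obtain ⟨j, hj, rfl⟩ := Finset.mem_image.1 hy
  have : Function.invFunOn x S (x j) = j := hinj.leftInvOn_invFunOn hj
  simp only [this]
  simpa [hj] using hfr j hj

/-- The Sauer–Shelah bound in exponential form. -/
theorem Finset.card_le_of_shatters_card_le {n d : ℕ} (𝒜 : Finset (Finset (Fin n)))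
    (h : ∀ s, 𝒜.Shatters s → s.card ≤ d) {x : ℝ} (hx0 : 0 < x) (hx1 : x ≤ 1) :
    (𝒜.card : ℝ) ≤ (1 / x) ^ d * Real.exp (n * x) := by
  have hd : 𝒜.vcDim ≤ d := Finset.sup_le fun s hs => h s (Finset.mem_shatterer.1 hs)
  have h1 : 𝒜.card ≤ ∑ k ∈ Finset.Iic 𝒜.vcDim, n.choose k := by
    simpa using (Finset.card_le_card_shatterer 𝒜).trans Finset.card_shatterer_le_sum_vcDim
  have h2 : 𝒜.card ≤ ∑ k ∈ Finset.Iic d, n.choose k :=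
    h1.trans (Finset.sum_le_sum_of_subset (Finset.Iic_subset_Iic.2 hd))
  -- As `x ≤ 1`, each term with `k ≤ d` may be weighted by `x ^ k / x ^ d ≥ 1`; the weighted sum is
  -- then completed to the binomial expansion of `(x + 1) ^ n`.
  have h3 : ∑ k ∈ Finset.Iic d, (n.choose k : ℝ) ≤ ∑ k ∈ Finset.Iic d, (1 / x) ^ d * (x ^ k * n.choose k) := by
    refine Finset.sum_le_sum fun k hk => ?_
    have hk : k ≤ d := Finset.mem_Iic.1 hk
    rw [← mul_assoc]
    refine le_mul_of_one_le_left (by positivity) ?_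
    rw [one_div, inv_pow, ← div_eq_inv_mul, le_div_iff₀ (by positivity), one_mul]
    exact pow_le_pow_of_le_one hx0.le hx1 hk
  have h4 : ∑ k ∈ Finset.Iic d, x ^ k * (n.choose k : ℝ) ≤ (x + 1) ^ n := by
    rw [add_pow]
    simp only [one_pow, mul_one]
    rw [Finset.sum_subset (Finset.subset_union_left (s₂ := Finset.Iic d) (s₁ := Finset.range (n + 1)))
      (f := fun k => x ^ k * (n.choose k : ℝ))]
    · exact Finset.sum_le_sum_of_subset_of_nonneg Finset.subset_union_right
        fun _ _ _ => by positivity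
    · intro k _ hk
      rw [Nat.choose_eq_zero_of_lt (by simpa using hk)]
      simp
  have h5 : (x + 1) ^ n ≤ Real.exp (n * x) := by
    rw [Real.exp_nat_mul]
    exact pow_le_pow_left₀ (by positivity) (Real.add_one_le_exp x) n
  calc (𝒜.card : ℝ) ≤ ∑ k ∈ Finset.Iic d, (n.choose k : ℝ) := by exact_mod_cast h2
    _ ≤ (1 / x) ^ d * ∑ k ∈ Finset.Iic d, x ^ k * (n.choose k : ℝ) := by
        rwa [Finset.mul_sum]
    _ ≤ _ := by gcongr; exact h4.trans h5

/-- The measure of the thresholds in `(0, 1]` that separate `a` from `b`. -/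
theorem integral_indicator_separating {a b : ℝ} (ha : a ∈ Icc (0 : ℝ) 1) (hb : b ∈ Icc (0 : ℝ) 1) :
    ∫ r in Ioc (0 : ℝ) 1, (Set.uIoc a b).indicator (fun _ => (1 : ℝ)) r = |a - b| := by
  rw [integral_indicator measurableSet_uIoc, Measure.restrict_restrict measurableSet_uIoc,
    Set.inter_eq_left.2 ?_]
  · simp only [setIntegral_const, smul_eq_mul, mul_one, uIoc, Real.volume_real_Ioc]
    rw [max_sub_min_eq_abs, max_eq_left (abs_nonneg _), abs_sub_comm]
  · rw [uIoc]
    exact Ioc_subset_Ioc (le_min ha.1 hb.1) (max_le ha.2 hb.2)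

/-- Some coordinate and threshold separate at least the average fraction of the pairs. -/
theorem exists_separating_threshold {J : Type*} [Fintype J] [Nonempty J]
    (Q : Finset ((J → ℝ) × (J → ℝ))) {e : ℝ}
    (h01 : ∀ q ∈ Q, ∀ j, q.1 j ∈ Icc (0 : ℝ) 1 ∧ q.2 j ∈ Icc (0 : ℝ) 1)
    (hsep : ∀ q ∈ Q, e * Fintype.card J ≤ ∑ j, |q.1 j - q.2 j|) :
    ∃ (j : J) (r : ℝ), ((Q.filter fun q => r ≤ q.1 j ↔ r ≤ q.2 j).card : ℝ) ≤ (1 - e) * Q.card := by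
  classical
  have hint : ∀ j, ∀ q ∈ Q, IntegrableOn (fun r => (Set.uIoc (q.1 j) (q.2 j)).indicator (fun _ => (1 : ℝ)) r)
      (Ioc 0 1) := fun j q _ => (integrable_const (1 : ℝ)).indicator measurableSet_uIoc
  have : IsProbabilityMeasure (volume.restrict (Ioc (0 : ℝ) 1)) := ⟨by simp⟩
  -- First moment method: for `r` uniform on `(0, 1]`, the number of separated pairs summed over all
  -- coordinates has mean at least `e * Q.card` per coordinate. Some `r` attains the mean, and then
  -- some `j` does.
  obtain ⟨r, hr⟩ := exists_integral_le (μ := volume.restrict (Ioc (0 : ℝ) 1))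
    (f := fun r => ∑ j, ∑ q ∈ Q, (Set.uIoc (q.1 j) (q.2 j)).indicator (fun _ => (1 : ℝ)) r)
    (integrable_finsetSum _ fun j _ => integrable_finsetSum _ (hint j))
  rw [integral_finsetSum _ fun j _ => integrable_finsetSum _ (hint j)] at hr
  have h1 : ∑ j : J, e * Q.card ≤ ∑ j, ∑ q ∈ Q, (Set.uIoc (q.1 j) (q.2 j)).indicator (fun _ => (1 : ℝ)) r := by
    refine le_trans ?_ hr
    have : ∀ j, ∫ r in Ioc (0 : ℝ) 1, ∑ q ∈ Q, (Set.uIoc (q.1 j) (q.2 j)).indicator (fun _ => (1 : ℝ)) r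
        = ∑ q ∈ Q, |q.1 j - q.2 j| := fun j => by
      rw [integral_finsetSum _ (hint j)]
      exact Finset.sum_congr rfl fun q hq =>
        integral_indicator_separating (h01 q hq j).1 (h01 q hq j).2
    simp only [this]
    rw [Finset.sum_comm]
    calc ∑ j : J, e * Q.card = ∑ q ∈ Q, e * Fintype.card J := by simp; ring
      _ ≤ _ := Finset.sum_le_sum hsep
  obtain ⟨j, -, hj⟩ := Finset.exists_le_of_sum_le Finset.univ_nonempty h1
  refine ⟨j, r, ?_⟩
  have h2 : ∑ q ∈ Q, (Set.uIoc (q.1 j) (q.2 j)).indicator (fun _ => (1 : ℝ)) r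
      = ((Q.filter fun q => ¬ (r ≤ q.1 j ↔ r ≤ q.2 j)).card : ℝ) := by
    rw [Finset.card_filter]
    push_cast
    refine Finset.sum_congr rfl fun q _ => ?_
    rw [Set.indicator_apply]
    congr 1
    rw [Set.mem_uIoc]
    simp only [eq_iff_iff]
    constructor
    · rintro (⟨h, h'⟩ | ⟨h, h'⟩) h''
      · exact absurd (h''.2 h') (not_le.2 h)
      · exact absurd (h''.1 h') (not_le.2 h)
    · intro h
      by_cases h' : r ≤ q.1 j
      · exact Or.inr ⟨not_le.1 fun h'' => h (iff_of_true h' h''), h'⟩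
      · exact Or.inl ⟨not_le.1 h', by_contra fun h'' => h (iff_of_false h' h'')⟩
  have h3 := Finset.card_filter_add_card_filter_not (s := Q) (fun q => (r ≤ q.1 j ↔ r ≤ q.2 j))
  have h4 : ((Q.filter fun q => (r ≤ q.1 j ↔ r ≤ q.2 j)).card : ℝ)
    + ((Q.filter fun q => ¬ (r ≤ q.1 j ↔ r ≤ q.2 j)).card : ℝ) = Q.card := by exact_mod_cast h3
  rw [h2] at hj
  linarith

/-- Greedy iteration: each new threshold is chosen for the pairs not yet separated and leaves at
most a fraction `1 - e` of them. -/
theorem exists_separating_thresholds {J : Type*} [Fintype J] [Nonempty J] {e : ℝ} (he : e ≤ 1)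
    (n : ℕ) (Q : Finset ((J → ℝ) × (J → ℝ)))
    (h01 : ∀ q ∈ Q, ∀ j, q.1 j ∈ Icc (0 : ℝ) 1 ∧ q.2 j ∈ Icc (0 : ℝ) 1)
    (hsep : ∀ q ∈ Q, e * Fintype.card J ≤ ∑ j, |q.1 j - q.2 j|) :
    ∃ (j : Fin n → J) (r : Fin n → ℝ),
      ((Q.filter fun q => ∀ k, r k ≤ q.1 (j k) ↔ r k ≤ q.2 (j k)).card : ℝ) ≤ (1 - e) ^ n * Q.card := by
  classical
  induction n generalizing Q with
  | zero => exact ⟨Fin.elim0, Fin.elim0, by simp⟩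
  | succ n ih =>
    obtain ⟨j₀, r₀, h₀⟩ := exists_separating_threshold Q h01 hsep
    obtain ⟨j, r, h⟩ := ih (Q.filter fun q => r₀ ≤ q.1 j₀ ↔ r₀ ≤ q.2 j₀)
      (fun q hq => h01 q (Finset.mem_of_mem_filter q hq))
      (fun q hq => hsep q (Finset.mem_of_mem_filter q hq))
    refine ⟨Fin.cons j₀ j, Fin.cons r₀ r, ?_⟩
    simp only [Fin.forall_fin_succ, Fin.cons_zero, Fin.cons_succ]
    rw [← Finset.filter_filter]
    refine h.trans ?_
    rw [pow_succ, mul_assoc]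
    exact mul_le_mul_of_nonneg_left h₀ (pow_nonneg (by linarith) _)

/-- A family of pseudo-dimension at most `d` that is `e`-separated in `L¹` has at most
`(8 / e) ^ (2 * d)` members. -/
theorem log_card_le_of_separated {J : Type*} [Fintype J] [Nonempty J] {d : ℕ} (hd : 1 ≤ d)
    (G : Finset (J → ℝ)) (hG : ∀ S : Finset J, PseudoShatters (G : Set (J → ℝ)) S → S.card ≤ d)
    (h01 : ∀ f ∈ G, ∀ j, f j ∈ Icc (0 : ℝ) 1) {e : ℝ} (he0 : 0 < e) (he1 : e ≤ 1)
    (hsep : ∀ f ∈ G, ∀ g ∈ G, f ≠ g → e * Fintype.card J ≤ ∑ j, |f j - g j|) :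
    Real.log G.card ≤ 2 * d * Real.log (8 / e) := by
  classical
  have hL : 2 ≤ Real.log (8 / e) := by
    have : Real.log 8 ≤ Real.log (8 / e) := by
      apply Real.log_le_log (by norm_num)
      rw [le_div_iff₀ he0]; linarith
    have h8 : Real.log 8 = 3 * Real.log 2 := by
      rw [show (8 : ℝ) = 2 ^ 3 by norm_num, Real.log_pow]; norm_num
    have := Real.log_two_gt_d9
    linarith
  have hd' : (1 : ℝ) ≤ d := by exact_mod_cast hd
  rcases G.eq_empty_or_nonempty with rfl | hne
  · simp; positivity
  have hK1 : (1 : ℝ) ≤ G.card := by exact_mod_cast hne.card_pos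
  set Λ := Real.log G.card with hΛ
  have hΛ0 : 0 ≤ Λ := Real.log_nonneg hK1
  -- With this `n`, `(1 - e) ^ n ≤ 1 / G.card ^ 2`, so fewer than one ordered pair of distinct
  -- members stays unseparated, that is, none.
  set n := ⌈2 * Λ / e⌉₊ with hn
  obtain ⟨j, r, hjr⟩ := exists_separating_thresholds he1 n G.offDiag
    (fun q hq i => ⟨h01 _ (Finset.mem_offDiag.1 hq).1 i, h01 _ (Finset.mem_offDiag.1 hq).2.1 i⟩)
    (fun q hq => hsep _ (Finset.mem_offDiag.1 hq).1 _ (Finset.mem_offDiag.1 hq).2.1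
      (Finset.mem_offDiag.1 hq).2.2)
  have hlt : (1 - e) ^ n * (G.offDiag.card : ℝ) < 1 := by
    have h1 : (1 - e) ^ n ≤ Real.exp (-(2 * Λ)) := by
      calc (1 - e) ^ n ≤ (Real.exp (-e)) ^ n :=
            pow_le_pow_left₀ (by linarith) (by linarith [Real.add_one_le_exp (-e)]) n
        _ = Real.exp (n * (-e)) := by rw [Real.exp_nat_mul]
        _ ≤ Real.exp (-(2 * Λ)) := by
            apply Real.exp_le_exp.2
            have := Nat.le_ceil (2 * Λ / e)
            rw [div_le_iff₀ he0] at this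
            linarith
    have h2 : (G.offDiag.card : ℝ) < Real.exp (2 * Λ) := by
      have h3 : Real.exp (2 * Λ) = (G.card : ℝ) * G.card := by
        rw [two_mul, Real.exp_add, hΛ, Real.exp_log (by linarith)]
      rw [h3, Finset.offDiag_card, Nat.cast_sub (by nlinarith [hne.card_pos])]
      push_cast
      linarith
    calc (1 - e) ^ n * (G.offDiag.card : ℝ) ≤ Real.exp (-(2 * Λ)) * G.offDiag.card := by gcongr
      _ < Real.exp (-(2 * Λ)) * Real.exp (2 * Λ) := by gcongr
      _ = 1 := by rw [← Real.exp_add]; simp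
  have hempty : (G.offDiag.filter fun q => ∀ k, r k ≤ q.1 (j k) ↔ r k ≤ q.2 (j k)) = ∅ := by
    rw [← Finset.card_eq_zero]
    have := hjr.trans_lt hlt
    exact Nat.lt_one_iff.1 (by exact_mod_cast this)
  let pat : (J → ℝ) → Finset (Fin n) := fun f => Finset.univ.filter fun k => r k ≤ f (j k)
  have hpat : Set.InjOn pat (G : Set (J → ℝ)) := by
    intro f hf g hg hfg
    by_contra hne
    have : (f, g) ∈ (G.offDiag.filter fun q => ∀ k, r k ≤ q.1 (j k) ↔ r k ≤ q.2 (j k)) := by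
      refine Finset.mem_filter.2 ⟨Finset.mem_offDiag.2 ⟨hf, hg, hne⟩, fun k => ?_⟩
      have := Finset.ext_iff.1 hfg k
      simpa [pat] using this
    simp [hempty] at this
  have hshat : ∀ s, (G.image pat).Shatters s → s.card ≤ d := by
    intro s hs
    have : PseudoShatters ((fun f : J → ℝ => f ∘ j) '' (G : Set (J → ℝ))) s := by
      refine ⟨r, fun T hT => ?_⟩
      obtain ⟨u, hu, hsu⟩ := hs hT
      obtain ⟨f, hf, rfl⟩ := Finset.mem_image.1 hu
      refine ⟨f ∘ j, ⟨f, hf, rfl⟩, fun k hk => ?_⟩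
      rw [← hsu]
      simp [pat, hk]
    obtain ⟨S', hc, -, hS'⟩ := PseudoShatters.exists_of_comp _ _ this
    exact hc ▸ hG S' hS'
  -- Since `n` is about `2 * Λ / e`, the choice `x = e / 8` makes `n * x` at most `Λ / 4 + 1 / 8`,
  -- which is absorbed into the left-hand side `Λ`.
  have hcard := Finset.card_le_of_shatters_card_le (G.image pat) hshat (x := e / 8)
    (by positivity) (by linarith)
  rw [Finset.card_image_of_injOn hpat] at hcard
  have hlog := Real.log_le_log (by linarith) hcard
  rw [Real.log_mul (by positivity) (by positivity), Real.log_exp, Real.log_pow, one_div_div,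
    ← hΛ] at hlog
  have hnle : (n : ℝ) ≤ 2 * Λ / e + 1 := (Nat.ceil_lt_add_one (by positivity)).le
  have h6 : (n : ℝ) * (e / 8) ≤ Λ / 4 + 1 / 8 := by
    calc (n : ℝ) * (e / 8) ≤ (2 * Λ / e + 1) * (e / 8) := by gcongr
      _ = Λ / 4 + e / 8 := by field_simp; ring
      _ ≤ _ := by linarith
  have h7 : 2 ≤ d * Real.log (8 / e) := by nlinarith
  linarith

/-! ### Sign sums and chaining -/

/-- The sign attached to a Boolean. -/
def boolSign (b : Bool) : ℝ := if b then 1 else -1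

theorem abs_boolSign (b : Bool) : |boolSign b| = 1 := by cases b <;> simp [boolSign]

/-- Chernoff's method under the uniform distribution on signs: the exponential moment factors into
hyperbolic cosines, `cosh y ≤ exp (y ^ 2 / 2)`, and `s = t / V` minimizes the exponent `s ^ 2 * V /
2 - s * t`. -/
theorem card_lt_sum_boolSign_le {N : ℕ} (a : Fin N → ℝ) {V t : ℝ} (hV : 0 < V) (ht : 0 ≤ t)
    (ha : ∑ i, a i ^ 2 ≤ V) :
    ((Finset.univ.filter fun b : Fin N → Bool => t < ∑ i, boolSign (b i) * a i).card : ℝ)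
      ≤ 2 ^ N * Real.exp (-(t ^ 2 / (2 * V))) := by
  set s := t / V with hs
  have hs0 : 0 ≤ s := by positivity
  have h1 : ∑ b : Fin N → Bool, Real.exp (s * ∑ i, boolSign (b i) * a i)
      = ∏ i, (2 * Real.cosh (s * a i)) := by
    have : ∀ i, 2 * Real.cosh (s * a i) = ∑ β : Bool, Real.exp (s * (boolSign β * a i)) := by
      intro i
      simp [boolSign, Real.cosh_eq]
      ring
    simp only [this, Fintype.prod_sum, Finset.mul_sum, Real.exp_sum]
  have h2 : ∏ i, (2 * Real.cosh (s * a i)) ≤ 2 ^ N * Real.exp (s ^ 2 * V / 2) := by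
    rw [Finset.prod_mul_distrib]
    simp only [Finset.prod_const, Finset.card_univ, Fintype.card_fin]
    refine mul_le_mul_of_nonneg_left ?_ (by positivity)
    calc ∏ i, Real.cosh (s * a i) ≤ ∏ i, Real.exp ((s * a i) ^ 2 / 2) :=
          Finset.prod_le_prod (fun i _ => (Real.cosh_pos _).le)
            fun i _ => Real.cosh_le_exp_half_sq _
      _ = Real.exp (s ^ 2 / 2 * ∑ i, a i ^ 2) := by
          rw [← Real.exp_sum, Finset.mul_sum]
          congr 1
          exact Finset.sum_congr rfl fun i _ => by ring
      _ ≤ _ := by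
          apply Real.exp_le_exp.2
          calc s ^ 2 / 2 * ∑ i, a i ^ 2 ≤ s ^ 2 / 2 * V := by gcongr
            _ = _ := by ring
  have h3 : ((Finset.univ.filter fun b : Fin N → Bool => t < ∑ i, boolSign (b i) * a i).card : ℝ)
      * Real.exp (s * t) ≤ ∑ b : Fin N → Bool, Real.exp (s * ∑ i, boolSign (b i) * a i) := by
    rw [← nsmul_eq_mul, ← Finset.sum_const]
    calc _ ≤ ∑ b ∈ (Finset.univ.filter fun b : Fin N → Bool => t < ∑ i, boolSign (b i) * a i),
          Real.exp (s * ∑ i, boolSign (b i) * a i) := by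
          refine Finset.sum_le_sum fun b hb => ?_
          have hb := (Finset.mem_filter.1 hb).2
          apply Real.exp_le_exp.2
          gcongr
      _ ≤ _ := Finset.sum_le_sum_of_subset_of_nonneg (Finset.subset_univ _)
          fun _ _ _ => (Real.exp_pos _).le
  have h4 := h3.trans (h1.le.trans h2)
  rw [← le_div_iff₀ (Real.exp_pos _), mul_div_assoc, ← Real.exp_sub] at h4
  refine h4.trans (le_of_eq ?_)
  congr 2
  rw [hs]
  field_simp
  ring

theorem card_lt_abs_sum_boolSign_le {N : ℕ} (a : Fin N → ℝ) {V t : ℝ} (hV : 0 < V) (ht : 0 ≤ t)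
    (ha : ∑ i, a i ^ 2 ≤ V) :
    ((Finset.univ.filter fun b : Fin N → Bool => t < |∑ i, boolSign (b i) * a i|).card : ℝ)
      ≤ 2 ^ N * (2 * Real.exp (-(t ^ 2 / (2 * V)))) := by
  classical
  have h1 := card_lt_sum_boolSign_le a hV ht ha
  have h2 := card_lt_sum_boolSign_le (fun i => -a i) hV ht (by simpa using ha)
  have h3 : (Finset.univ.filter fun b : Fin N → Bool => t < |∑ i, boolSign (b i) * a i|) ⊆
      (Finset.univ.filter fun b : Fin N → Bool => t < ∑ i, boolSign (b i) * a i) ∪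
      (Finset.univ.filter fun b : Fin N → Bool => t < ∑ i, boolSign (b i) * -a i) := by
    intro b hb
    simpa [lt_abs] using hb
  have h4 := (Finset.card_le_card h3).trans (Finset.card_union_le _ _)
  have h5 : ((Finset.univ.filter fun b : Fin N → Bool => t < |∑ i, boolSign (b i) * a i|).card : ℝ)
    ≤ ((Finset.univ.filter fun b : Fin N → Bool => t < ∑ i, boolSign (b i) * a i).card : ℝ) +
      ((Finset.univ.filter fun b : Fin N → Bool => t < ∑ i, boolSign (b i) * -a i).card : ℝ) := by
    exact_mod_cast h4
  linarith

/-- A maximal separated subfamily is a net. -/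
theorem exists_separated_net {J : Type*} [Fintype J] (F : Finset (J → ℝ)) {η : ℝ} (hη : 0 ≤ η) :
    ∃ G ⊆ F, (∀ f ∈ G, ∀ g ∈ G, f ≠ g → η < ∑ j, (f j - g j) ^ 2) ∧
      ∀ f ∈ F, ∃ g ∈ G, ∑ j, (f j - g j) ^ 2 ≤ η := by
  classical
  induction F using Finset.induction_on with
  | empty => exact ⟨∅, by simp⟩
  | insert a F _ ih =>
    obtain ⟨G, hGF, hsep, hnet⟩ := ih
    by_cases h : ∃ g ∈ G, ∑ j, (a j - g j) ^ 2 ≤ η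
    · refine ⟨G, hGF.trans (Finset.subset_insert _ _), hsep, fun f hf => ?_⟩
      rcases Finset.mem_insert.1 hf with rfl | hf
      · exact h
      · exact hnet f hf
    · push Not at h
      refine ⟨insert a G, Finset.insert_subset_insert _ hGF, fun f hf g hg hfg => ?_, fun f hf => ?_⟩
      · rcases Finset.mem_insert.1 hf with rfl | hf' <;> rcases Finset.mem_insert.1 hg with rfl | hg'
        · exact absurd rfl hfg
        · exact h g hg'
        · simpa only [← neg_sub (g _) (f _), neg_sq] using h f hf'
        · exact hsep f hf' g hg' hfg
      · rcases Finset.mem_insert.1 hf with rfl | hf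
        · exact ⟨f, Finset.mem_insert_self _ _, by simpa using hη⟩
        · obtain ⟨g, hg, hfg⟩ := hnet f hf
          exact ⟨g, Finset.mem_insert_of_mem hg, hfg⟩

/-- For values in `[0,1]` the squared difference is at most the absolute difference, so an
`L²`-separated set is `L¹`-separated with `e = (1 / 4) ^ k`, and the packing bound applies. The
exponent comes from `2 * d * (2 * k + 3) * log 2 ≤ 5 * d * (k + 1)`. -/
theorem exists_dyadic_net {J : Type*} [Fintype J] [Nonempty J] {d : ℕ} (hd : 1 ≤ d)
    (F : Finset (J → ℝ)) (hF : ∀ S : Finset J, PseudoShatters (F : Set (J → ℝ)) S → S.card ≤ d)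
    (h01 : ∀ f ∈ F, ∀ j, f j ∈ Icc (0 : ℝ) 1) (k : ℕ) :
    ∃ G ⊆ F, (G.card : ℝ) ≤ Real.exp (5 * d * (k + 1)) ∧
      ∀ f ∈ F, ∃ g ∈ G, ∑ j, (f j - g j) ^ 2 ≤ (1 / 4) ^ k * Fintype.card J := by
  obtain ⟨G, hGF, hsep, hnet⟩ := exists_separated_net F
    (η := (1 / 4) ^ k * Fintype.card J) (by positivity)
  refine ⟨G, hGF, ?_, hnet⟩
  rcases G.eq_empty_or_nonempty with rfl | hne
  · simp; positivity
  have hlog := log_card_le_of_separated hd G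
    (fun S ⟨r, hr⟩ => hF S ⟨r, fun T hT => let ⟨f, hf, h⟩ := hr T hT; ⟨f, hGF hf, h⟩⟩)
    (fun f hf => h01 f (hGF hf)) (e := (1 / 4) ^ k) (by positivity)
    (pow_le_one₀ (by norm_num) (by norm_num)) fun f hf g hg hfg => by
      refine (hsep f hf g hg hfg).le.trans (Finset.sum_le_sum fun j _ => ?_)
      have h1 := h01 f (hGF hf) j
      have h2 := h01 g (hGF hg) j
      rw [← sq_abs]
      have : |f j - g j| ≤ 1 := abs_le.2 ⟨by linarith [h1.1, h2.2], by linarith [h1.2, h2.1]⟩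
      nlinarith [abs_nonneg (f j - g j)]
  have h8 : Real.log (8 / (1 / 4) ^ k) = (2 * k + 3) * Real.log 2 := by
    rw [show (8 : ℝ) / (1 / 4) ^ k = 2 ^ (2 * k + 3) by
      rw [pow_add, pow_mul, one_div, inv_pow, div_inv_eq_mul]; norm_num [mul_comm], Real.log_pow]
    push_cast; ring
  have hlt := Real.log_two_lt_d9
  rw [← Real.log_le_iff_le_exp (by exact_mod_cast hne.card_pos)]
  refine hlog.trans ?_
  rw [h8]
  have : (2 * (k : ℝ) + 3) * Real.log 2 ≤ 5 / 2 * (k + 1) := by nlinarith [(Nat.cast_nonneg k : (0:ℝ) ≤ k)]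
  calc 2 * (d : ℝ) * ((2 * k + 3) * Real.log 2) ≤ 2 * d * (5 / 2 * (k + 1)) := by gcongr
    _ = _ := by ring

theorem sum_succ_mul_half_pow_le (n : ℕ) :
    ∑ k ∈ Finset.range n, ((k : ℝ) + 1) * (1 / 2) ^ k ≤ 4 := by
  have : ∑ k ∈ Finset.range n, ((k : ℝ) + 1) * (1 / 2) ^ k = 4 - (2 * n + 4) * (1 / 2) ^ n := by
    induction n with
    | zero => simp
    | succ n ih => rw [Finset.sum_range_succ, ih, pow_succ]; push_cast; ring
  rw [this]
  have : (0 : ℝ) ≤ (2 * n + 4) * (1 / 2) ^ n := by positivity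
  linarith

/-- The sum of the signed differences of the two halves of a vector. -/
def signedDiff {N : ℕ} (b : Fin N → Bool) (f : Fin N × Bool → ℝ) : ℝ :=
  ∑ i, boolSign (b i) * (f (i, true) - f (i, false))

theorem signedDiff_sub {N : ℕ} (b : Fin N → Bool) (f g : Fin N × Bool → ℝ) :
    signedDiff b (f - g) = signedDiff b f - signedDiff b g := by
  simp only [signedDiff, Pi.sub_apply, ← Finset.sum_sub_distrib]
  exact Finset.sum_congr rfl fun i _ => by ring

theorem sum_diff_sq_le {N : ℕ} (f : Fin N × Bool → ℝ) :
    ∑ i, (f (i, true) - f (i, false)) ^ 2 ≤ 2 * ∑ j, f j ^ 2 := by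
  rw [Fintype.sum_prod_type, Finset.mul_sum]
  refine Finset.sum_le_sum fun i _ => ?_
  simp only [Fintype.sum_bool]
  nlinarith [sq_nonneg (f (i, true) + f (i, false))]

theorem abs_signedDiff_le {N : ℕ} (b : Fin N → Bool) (f : Fin N × Bool → ℝ) {s : ℝ} (hs : 0 ≤ s)
    (h : ∑ j, f j ^ 2 ≤ s ^ 2 * (N * 2)) : |signedDiff b f| ≤ 2 * N * s := by
  have h1 : |signedDiff b f| ≤ ∑ i, |f (i, true) - f (i, false)| := by
    refine (Finset.abs_sum_le_sum_abs _ _).trans (Finset.sum_le_sum fun i _ => ?_)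
    rw [abs_mul, abs_boolSign, one_mul]
  refine h1.trans (abs_le_of_sq_le_sq' ?_ (by positivity)).2
  have h2 := sq_sum_le_card_mul_sum_sq (s := Finset.univ)
    (f := fun i : Fin N => |f (i, true) - f (i, false)|)
  simp only [sq_abs, Finset.card_univ, Fintype.card_fin] at h2
  calc _ ≤ (N : ℝ) * ∑ i, (f (i, true) - f (i, false)) ^ 2 := h2
    _ ≤ N * (2 * (s ^ 2 * (N * 2))) := by
        gcongr; exact (sum_diff_sq_le f).trans (by gcongr)
    _ = _ := by ring

/-- Union bound over the links of level `k`. The tail exponent is `8 * (k + 1) ^ 2 * (√d + u) ^ 2`;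
it beats the entropy `5 * d * (k + 1)` and still leaves `u ^ 2` and a factor summable in `k`. -/
theorem card_chain_link_le {N d k : ℕ} (hN : 1 ≤ N) (hd : 1 ≤ d) {u : ℝ} (hu : 0 ≤ u)
    (G : Finset (Fin N × Bool → ℝ)) (hG : (G.card : ℝ) ≤ Real.exp (5 * d * (k + 1)))
    (a : (Fin N × Bool → ℝ) → (Fin N × Bool → ℝ))
    (ha : ∀ g ∈ G, ∑ j, (a g j) ^ 2 ≤ 8 * N * (1 / 4) ^ k) :
    ((Finset.univ.filter fun b : Fin N → Bool =>
      ∃ g ∈ G, 16 * √N * (√d + u) * ((k + 1) * (1 / 2) ^ k) < |signedDiff b (a g)|).card : ℝ)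
      ≤ 2 ^ N * Real.exp (-u ^ 2) * (1 / 2) ^ (k + 1) := by
  classical
  have hN' : (1 : ℝ) ≤ N := by exact_mod_cast hN
  have hd' : (1 : ℝ) ≤ d := by exact_mod_cast hd
  set t := 16 * √N * (√d + u) * ((k + 1) * (1 / 2) ^ k) with ht
  have ht0 : 0 ≤ t := by positivity
  have hV : (0 : ℝ) < 16 * N * (1 / 4) ^ k := by positivity
  have h1 : ∀ g ∈ G, ((Finset.univ.filter fun b : Fin N → Bool => t < |signedDiff b (a g)|).card : ℝ)
      ≤ 2 ^ N * (2 * Real.exp (-(t ^ 2 / (2 * (16 * N * (1 / 4) ^ k))))) := fun g hg =>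
    card_lt_abs_sum_boolSign_le _ hV ht0
      ((sum_diff_sq_le (a g)).trans (by linarith [ha g hg]))
  have h2 : t ^ 2 / (2 * (16 * N * (1 / 4) ^ k)) = 8 * ((k + 1) ^ 2 * (√d + u) ^ 2) := by
    have : ((1 : ℝ) / 4) ^ k = ((1 / 2) ^ k) ^ 2 := by rw [← pow_mul, mul_comm, pow_mul]; norm_num
    rw [ht, this, div_eq_iff (by positivity)]
    simp only [mul_pow, Real.sq_sqrt (Nat.cast_nonneg N)]
    ring
  have h3 : d + u ^ 2 ≤ (√d + u) ^ 2 := by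
    have := Real.sq_sqrt (Nat.cast_nonneg (α := ℝ) d)
    nlinarith [Real.sqrt_nonneg (d : ℝ), mul_nonneg (Real.sqrt_nonneg (d : ℝ)) hu]
  have h4 : 5 * (d : ℝ) * (k + 1) + -(8 * ((k + 1) ^ 2 * (√d + u) ^ 2)) ≤ -u ^ 2 + (k + 1 : ℕ) * (-3) := by
    have hk : (1 : ℝ) ≤ k + 1 := by linarith [(Nat.cast_nonneg k : (0 : ℝ) ≤ k)]
    have h5 : (k + 1 : ℝ) * (d + u ^ 2) ≤ (k + 1) ^ 2 * (√d + u) ^ 2 := by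
      calc (k + 1 : ℝ) * (d + u ^ 2) ≤ (k + 1) * (√d + u) ^ 2 := by gcongr
        _ ≤ (k + 1) ^ 2 * (√d + u) ^ 2 := by gcongr; nlinarith
    push_cast
    nlinarith [mul_nonneg (sub_nonneg.2 hk) (sq_nonneg u),
      mul_nonneg (by linarith : (0 : ℝ) ≤ k + 1) (sub_nonneg.2 hd')]
  have h5 : 2 * Real.exp ((k + 1 : ℕ) * (-3)) ≤ (1 / 2) ^ (k + 1) := by
    rw [Real.exp_nat_mul]
    have : Real.exp (-3) ≤ 1 / 4 := by
      rw [Real.exp_neg, one_div]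
      apply inv_anti₀ (by norm_num)
      linarith [Real.add_one_le_exp (3 : ℝ)]
    calc 2 * Real.exp (-3) ^ (k + 1) ≤ 2 * (1 / 4) ^ (k + 1) := by gcongr
      _ = 2 * (1 / 2) ^ (k + 1) * (1 / 2) ^ (k + 1) := by
          rw [mul_assoc, ← mul_pow]; norm_num
      _ ≤ 1 * (1 / 2) ^ (k + 1) := by
          gcongr
          rw [pow_succ]
          have : ((1 : ℝ) / 2) ^ k ≤ 1 := pow_le_one₀ (by norm_num) (by norm_num)
          linarith
      _ = _ := one_mul _
  have h6 : (Finset.univ.filter fun b : Fin N → Bool => ∃ g ∈ G, t < |signedDiff b (a g)|) ⊆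
      G.biUnion fun g => Finset.univ.filter fun b : Fin N → Bool => t < |signedDiff b (a g)| := by
    intro b hb
    simpa using hb
  calc _ ≤ ((G.biUnion fun g => Finset.univ.filter fun b : Fin N → Bool =>
          t < |signedDiff b (a g)|).card : ℝ) := by exact_mod_cast Finset.card_le_card h6
    _ ≤ ∑ g ∈ G, ((Finset.univ.filter fun b : Fin N → Bool => t < |signedDiff b (a g)|).card : ℝ) := by
        exact_mod_cast Finset.card_biUnion_le
    _ ≤ ∑ g ∈ G, 2 ^ N * (2 * Real.exp (-(8 * ((k + 1) ^ 2 * (√d + u) ^ 2)))) := by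
        rw [← h2]; exact Finset.sum_le_sum h1
    _ = G.card * (2 ^ N * (2 * Real.exp (-(8 * ((k + 1) ^ 2 * (√d + u) ^ 2))))) := by simp
    _ ≤ Real.exp (5 * d * (k + 1)) * (2 ^ N * (2 * Real.exp (-(8 * ((k + 1) ^ 2 * (√d + u) ^ 2))))) := by
        gcongr
    _ = 2 ^ N * (2 * Real.exp (5 * d * (k + 1) + -(8 * ((k + 1) ^ 2 * (√d + u) ^ 2)))) := by
        rw [Real.exp_add]; ring
    _ ≤ 2 ^ N * (2 * Real.exp (-u ^ 2 + (k + 1 : ℕ) * (-3))) := by gcongr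
    _ = 2 ^ N * Real.exp (-u ^ 2) * (2 * Real.exp ((k + 1 : ℕ) * (-3))) := by
        rw [Real.exp_add]; ring
    _ ≤ _ := by gcongr

/-- Chaining: for most choices of signs, the signed differences of all members of a family of
small pseudo-dimension are small. -/
theorem card_exists_lt_abs_signedDiff_le {N d : ℕ} (hN : 1 ≤ N) (hd : 1 ≤ d) {u : ℝ} (hu : 0 ≤ u)
    (F : Finset (Fin N × Bool → ℝ))
    (hF : ∀ S : Finset (Fin N × Bool), PseudoShatters (F : Set (Fin N × Bool → ℝ)) S → S.card ≤ d)
    (h01 : ∀ f ∈ F, ∀ j, f j ∈ Icc (0 : ℝ) 1) :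
    ((Finset.univ.filter fun b : Fin N → Bool =>
      ∃ f ∈ F, 66 * √N * (√d + u) < |signedDiff b f|).card : ℝ) ≤ 2 ^ N * Real.exp (-u ^ 2) := by
  classical
  have : NeZero N := ⟨by omega⟩
  have hN' : (1 : ℝ) ≤ N := by exact_mod_cast hN
  have hd' : (1 : ℝ) ≤ d := by exact_mod_cast hd
  choose G hGF hGcard hnet using exists_dyadic_net hd F hF h01
  choose! π hπG hπ using hnet
  -- The chain starts from the zero function, so a link of level `0` is the net function itself.
  let prev : ℕ → (Fin N × Bool → ℝ) → (Fin N × Bool → ℝ) := fun k g =>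
    match k with
    | 0 => 0
    | k + 1 => π k g
  have hcard : (Fintype.card (Fin N × Bool) : ℝ) = N * 2 := by simp
  have hlink : ∀ k, ∀ g ∈ G k, ∑ j, ((g - prev k g) j) ^ 2 ≤ 8 * N * (1 / 4) ^ k := by
    intro k g hg
    cases k with
    | zero =>
      calc ∑ j, ((g - prev 0 g) j) ^ 2 ≤ ∑ j : Fin N × Bool, (1 : ℝ) := by
            refine Finset.sum_le_sum fun j _ => ?_
            have := h01 g (hGF 0 hg) j
            simp only [prev, sub_zero]
            nlinarith [this.1, this.2]
        _ = N * 2 := by simp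
        _ ≤ _ := by simp only [pow_zero]; linarith
    | succ k =>
      refine (hπ k g (hGF _ hg)).trans (le_of_eq ?_)
      rw [hcard, pow_succ]; ring
  let bad : ℕ → Finset (Fin N → Bool) := fun k => Finset.univ.filter fun b =>
    ∃ g ∈ G k, 16 * √N * (√d + u) * ((k + 1) * (1 / 2) ^ k) < |signedDiff b (g - prev k g)|
  have hbad : ∀ k, ((bad k).card : ℝ) ≤ 2 ^ N * Real.exp (-u ^ 2) * (1 / 2) ^ (k + 1) := fun k =>
    card_chain_link_le hN hd hu (G k) (hGcard k) (fun g => g - prev k g) (hlink k)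
  have hchain : ∀ b, ∀ n, (∀ k ≤ n, b ∉ bad k) → ∀ g ∈ G n,
      |signedDiff b g| ≤ 16 * √N * (√d + u) * ∑ k ∈ Finset.range (n + 1), ((k : ℝ) + 1) * (1 / 2) ^ k := by
    intro b n
    have step : ∀ k, b ∉ bad k → ∀ g ∈ G k, |signedDiff b g| ≤
        |signedDiff b (prev k g)| + 16 * √N * (√d + u) * ((k + 1) * (1 / 2) ^ k) := by
      intro k hb g hg
      have h1 : |signedDiff b (g - prev k g)| ≤ 16 * √N * (√d + u) * ((k + 1) * (1 / 2) ^ k) := by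
        by_contra h
        exact hb (Finset.mem_filter.2 ⟨Finset.mem_univ _, g, hg, not_le.1 h⟩)
      rw [signedDiff_sub] at h1
      linarith [abs_sub_abs_le_abs_sub (signedDiff b g) (signedDiff b (prev k g))]
    induction n with
    | zero =>
      intro h g hg
      refine (step 0 (h 0 le_rfl) g hg).trans (le_of_eq ?_)
      simp [prev, signedDiff]
    | succ n ih =>
      intro h g hg
      refine (step (n + 1) (h _ le_rfl) g hg).trans ?_
      rw [Finset.sum_range_succ, mul_add (16 * √N * (√d + u))]
      exact add_le_add (ih (fun k hk => h k (by omega)) _ (hπG n g (hGF _ hg))) le_rfl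
  -- The chain stops at level `N`, where the remainder is at most `2 * N * (1 / 2) ^ N ≤ 2`. The
  -- links add up to at most `16 * 4` times `√N * (√d + u) ≥ 1`, whence `66 = 16 * 4 + 2`.
  have hsub : (Finset.univ.filter fun b : Fin N → Bool =>
      ∃ f ∈ F, 66 * √N * (√d + u) < |signedDiff b f|) ⊆ (Finset.range (N + 1)).biUnion bad := by
    intro b hb
    obtain ⟨f, hf, hlt⟩ := (Finset.mem_filter.1 hb).2
    by_contra hnot
    have hgood : ∀ k ≤ N, b ∉ bad k := fun k hk hk' =>
      hnot (Finset.mem_biUnion.2 ⟨k, Finset.mem_range.2 (by omega), hk'⟩)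
    have h1 := hchain b N hgood _ (hπG N f hf)
    have h2 : |signedDiff b (f - π N f)| ≤ 2 * N * (1 / 2) ^ N := by
      refine abs_signedDiff_le b _ (by positivity) ((hπ N f hf).trans (le_of_eq ?_))
      rw [hcard, ← pow_mul, mul_comm N 2, pow_mul]
      norm_num
    have h3 : (N : ℝ) * (1 / 2) ^ N ≤ 1 := by
      rw [one_div, inv_pow, ← div_eq_mul_inv, div_le_one (by positivity)]
      exact_mod_cast (Nat.lt_two_pow_self (n := N)).le
    have h4 : 16 * √N * (√d + u) * ∑ k ∈ Finset.range (N + 1), ((k : ℝ) + 1) * (1 / 2) ^ k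
        ≤ 16 * √N * (√d + u) * 4 := by
      gcongr
      exact sum_succ_mul_half_pow_le _
    have h5 : 1 ≤ √N * (√d + u) := by
      have hn : 1 ≤ √(N : ℝ) := Real.one_le_sqrt.2 hN'
      have hd1 : 1 ≤ √(d : ℝ) := Real.one_le_sqrt.2 hd'
      nlinarith
    rw [signedDiff_sub] at h2
    linarith [abs_sub_abs_le_abs_sub (signedDiff b f) (signedDiff b (π N f))]
  calc _ ≤ (((Finset.range (N + 1)).biUnion bad).card : ℝ) := by
        exact_mod_cast Finset.card_le_card hsub
    _ ≤ ∑ k ∈ Finset.range (N + 1), ((bad k).card : ℝ) := by exact_mod_cast Finset.card_biUnion_le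
    _ ≤ ∑ k ∈ Finset.range (N + 1), 2 ^ N * Real.exp (-u ^ 2) * (1 / 2) ^ (k + 1) :=
        Finset.sum_le_sum fun k _ => hbad k
    _ = 2 ^ N * Real.exp (-u ^ 2) * (1 - (1 / 2) ^ (N + 1)) := by
        rw [← Finset.mul_sum]
        congr 1
        have : ∀ n : ℕ, ∑ k ∈ Finset.range n, ((1 : ℝ) / 2) ^ (k + 1) = 1 - (1 / 2) ^ n := by
          intro n
          induction n with
          | zero => simp
          | succ n ih => rw [Finset.sum_range_succ, ih, pow_succ]; ring
        exact this _
    _ ≤ 2 ^ N * Real.exp (-u ^ 2) * 1 := by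
        gcongr
        linarith [show (0 : ℝ) ≤ (1 / 2) ^ (N + 1) by positivity]
    _ = _ := mul_one _

/-! ### Symmetrization and uniform convergence -/

/-- The average of `g` over a sample. -/
def sampleMean {Ω : Type*} {N : ℕ} (g : Ω → ℝ) (s : Fin N → Ω) : ℝ :=
  (1 / (N : ℝ)) * ∑ k, g (s k)

theorem measurable_sampleMean {Ω : Type*} [MeasurableSpace Ω] {N : ℕ} {g : Ω → ℝ}
    (hg : Measurable g) : Measurable (sampleMean (N := N) g) := by
  unfold sampleMean
  fun_prop

/-- Chebyshev's inequality: a variable with values in `[0,1]` has variance at most `1 / 4`, so the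
sample mean has variance at most `1 / (4 * N)`, while `t ^ 2 * N ≥ 1`. -/
theorem half_le_measure_abs_sampleMean_sub_le {Ω : Type*} [MeasurableSpace Ω] (μ : Measure Ω)
    [IsProbabilityMeasure μ] {g : Ω → ℝ} (hg : Measurable g) (h01 : ∀ᵐ x ∂μ, g x ∈ Icc (0 : ℝ) 1)
    {N : ℕ} (hN : 1 ≤ N) {t : ℝ} (ht : 1 ≤ t * √N) :
    1 / 2 ≤ Measure.pi (fun _ : Fin N => μ) {s | |sampleMean g s - ∫ x, g x ∂μ| ≤ t} := by
  have hN' : (1 : ℝ) ≤ N := by exact_mod_cast hN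
  have hsN : 0 < √(N : ℝ) := Real.sqrt_pos.2 (by linarith)
  have ht0 : 0 < t := pos_of_mul_pos_left (by linarith) hsN.le
  set ν := Measure.pi (fun _ : Fin N => μ) with hν
  have hmem : MemLp g 2 μ := memLp_of_bounded h01 hg.aestronglyMeasurable 2
  have hint : Integrable g μ := hmem.integrable (by norm_num)
  have hcomp : ∀ k : Fin N, MemLp (fun s : Fin N → Ω => g (s k)) 2 ν := fun k =>
    hmem.comp_measurePreserving (measurePreserving_eval (fun _ : Fin N => μ) k)
  have hmean : ∫ s, sampleMean (N := N) g s ∂ν = ∫ x, g x ∂μ := by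
    simp only [sampleMean]
    rw [integral_const_mul, integral_finsetSum _ fun k _ => (hcomp k).integrable (by norm_num)]
    have : ∀ k : Fin N, ∫ s, g (s k) ∂ν = ∫ x, g x ∂μ := fun k =>
      integral_comp_eval (μ := fun _ : Fin N => μ) hg.aestronglyMeasurable
    simp only [this, Finset.sum_const, Finset.card_univ, Fintype.card_fin, nsmul_eq_mul]
    field_simp
  have hvar : ProbabilityTheory.variance (sampleMean (N := N) g) ν ≤ 1 / (4 * N) := by
    have h1 : ProbabilityTheory.variance (∑ k : Fin N, fun s : Fin N → Ω => g (s k)) ν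
        = ∑ k : Fin N, ProbabilityTheory.variance g μ :=
      ProbabilityTheory.variance_sum_pi (μ := fun _ : Fin N => μ) (X := fun _ => g) fun _ => hmem
    have h2 : ProbabilityTheory.variance g μ ≤ ((1 - 0) / 2) ^ 2 :=
      ProbabilityTheory.variance_le_sq_of_bounded h01 hg.aemeasurable
    have h3 : sampleMean (N := N) g
        = fun s => (1 / (N : ℝ)) * (∑ k : Fin N, fun s : Fin N → Ω => g (s k)) s := by
      ext s; simp [sampleMean]
    rw [h3, ProbabilityTheory.variance_const_mul, h1]
    simp only [Finset.sum_const, Finset.card_univ, Fintype.card_fin, nsmul_eq_mul]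
    calc (1 / (N : ℝ)) ^ 2 * (N * ProbabilityTheory.variance g μ)
        ≤ (1 / (N : ℝ)) ^ 2 * (N * ((1 - 0) / 2) ^ 2) := by gcongr
      _ = _ := by field_simp; norm_num
  have hmemS : MemLp (sampleMean (N := N) g) 2 ν := by
    unfold sampleMean
    exact (memLp_finsetSum _ fun k _ => hcomp k).const_mul _
  have hcheb := ProbabilityTheory.meas_ge_le_variance_div_sq hmemS ht0
  rw [hmean] at hcheb
  have hsmall : ν {s | t ≤ |sampleMean g s - ∫ x, g x ∂μ|} ≤ 1 / 2 := by
    refine hcheb.trans ?_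
    rw [show (1 / 2 : ENNReal) = ENNReal.ofReal (1 / 2) by
      rw [ENNReal.ofReal_div_of_pos (by norm_num)]; simp]
    apply ENNReal.ofReal_le_ofReal
    rw [div_le_iff₀ (by positivity)]
    refine hvar.trans ?_
    have h5 : 1 ≤ t ^ 2 * N := by
      have := Real.sq_sqrt (Nat.cast_nonneg (α := ℝ) N)
      nlinarith
    rw [div_le_iff₀ (by positivity)]
    linarith
  have hms : MeasurableSet {s : Fin N → Ω | |sampleMean g s - ∫ x, g x ∂μ| ≤ t} :=
    measurableSet_le ((measurable_sampleMean hg).sub_const _).norm measurable_const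
  have hcs : ν {s : Fin N → Ω | |sampleMean g s - ∫ x, g x ∂μ| ≤ t}ᶜ ≤ 1 / 2 := by
    refine (measure_mono fun s hs => ?_).trans hsmall
    exact (not_le.1 (show ¬ |sampleMean g s - ∫ x, g x ∂μ| ≤ t from hs)).le
  have h1 := measure_add_measure_compl (μ := ν) hms
  rw [measure_univ] at h1
  by_contra hlt
  rw [not_le] at hlt
  have : ν {s : Fin N → Ω | |sampleMean g s - ∫ x, g x ∂μ| ≤ t} +
      ν {s : Fin N → Ω | |sampleMean g s - ∫ x, g x ∂μ| ≤ t}ᶜ < 1 / 2 + 1 / 2 :=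
    ENNReal.add_lt_add_of_lt_of_le (ne_top_of_le_ne_top (by simp) hcs) hlt hcs
  rw [h1, ENNReal.add_halves] at this
  exact lt_irrefl _ this

/-- Symmetrization: deviations from the mean are controlled by deviations from a ghost sample. -/
theorem measure_exists_lt_abs_sampleMean_sub_integral_le {Ω : Type*} [MeasurableSpace Ω]
    (μ : Measure Ω) [IsProbabilityMeasure μ] {ι : Type*} [Countable ι] {g : ι → Ω → ℝ}
    (hg : ∀ i, Measurable (g i)) (h01 : ∀ i, ∀ᵐ x ∂μ, g i x ∈ Icc (0 : ℝ) 1)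
    {N : ℕ} (hN : 1 ≤ N) {t : ℝ} (ht : 1 ≤ t * √N) :
    Measure.pi (fun _ : Fin N => μ) {s | ∃ i, 2 * t < |sampleMean (g i) s - ∫ x, g i x ∂μ|}
      ≤ 2 * Measure.pi (fun _ : Fin N => μ.prod μ) {w | ∃ i,
        t < |sampleMean (g i) (fun k => (w k).1) - sampleMean (g i) (fun k => (w k).2)|} := by
  set ν := Measure.pi (fun _ : Fin N => μ) with hν
  set B : Set ((Fin N → Ω) × (Fin N → Ω)) :=
    {p | ∃ i, t < |sampleMean (g i) p.1 - sampleMean (g i) p.2|} with hB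
  set A : Set (Fin N → Ω) := {s | ∃ i, 2 * t < |sampleMean (g i) s - ∫ x, g i x ∂μ|} with hA
  have hmB : MeasurableSet B := by
    rw [hB, ofPred_exists]
    refine MeasurableSet.iUnion fun i => measurableSet_lt measurable_const ?_
    exact (((measurable_sampleMean (hg i)).comp measurable_fst).sub
      ((measurable_sampleMean (hg i)).comp measurable_snd)).norm
  have hmA : MeasurableSet A := by
    rw [hA, ofPred_exists]
    exact MeasurableSet.iUnion fun i => measurableSet_lt measurable_const
      ((measurable_sampleMean (hg i)).sub_const _).norm
  have h1 : Measure.pi (fun _ : Fin N => μ.prod μ) {w | ∃ i,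
        t < |sampleMean (g i) (fun k => (w k).1) - sampleMean (g i) (fun k => (w k).2)|}
      = (ν.prod ν) B :=
    (measurePreserving_arrowProdEquivProdArrow Ω Ω (Fin N) (fun _ => μ)
      (fun _ => μ)).measure_preimage hmB.nullMeasurableSet
  classical
  rw [h1, Measure.prod_apply hmB]
  -- If `s` deviates by more than `2 * t` for the index `i`, every ghost sample whose mean for this
  -- same `i` is `t`-accurate lies in the section of `B` over `s`.
  have h2 : ∀ s ∈ A, (1 / 2 : ENNReal) ≤ ν (Prod.mk s ⁻¹' B) := by
    rintro s ⟨i, hi⟩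
    refine (half_le_measure_abs_sampleMean_sub_le μ (hg i) (h01 i) hN ht).trans
      (measure_mono fun s' hs' => ⟨i, ?_⟩)
    have h3 : |sampleMean (g i) s' - ∫ x, g i x ∂μ| ≤ t := hs'
    have h4 := abs_sub_le (sampleMean (g i) s) (sampleMean (g i) s') (∫ x, g i x ∂μ)
    show t < |sampleMean (g i) s - sampleMean (g i) s'|
    linarith
  have h3 : (1 / 2 : ENNReal) * ν A ≤ ∫⁻ s, ν (Prod.mk s ⁻¹' B) ∂ν := by
    rw [← lintegral_indicator_const hmA]
    refine lintegral_mono fun s => ?_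
    rw [Set.indicator_apply]
    split_ifs with hs
    · exact h2 s hs
    · exact zero_le
  calc ν A = 2 * ((1 / 2 : ENNReal) * ν A) := by
        rw [← mul_assoc, one_div, ENNReal.mul_inv_cancel (by simp) (by simp), one_mul]
    _ ≤ _ := by gcongr

theorem PseudoShatters.mono {α : Type*} {F F' : Set (α → ℝ)} (h : F ⊆ F') {S : Finset α}
    (hS : PseudoShatters F S) : PseudoShatters F' S :=
  let ⟨r, hr⟩ := hS
  ⟨r, fun T hT => let ⟨f, hf, hfr⟩ := hr T hT; ⟨f, h hf, hfr⟩⟩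

/-- Chaining on a fixed pair of samples. -/
theorem card_exists_lt_abs_signedDiff_comp_le {Ω : Type*} {ι : Type*} {g : ι → Ω → ℝ} {Y : Set Ω}
    (h01 : ∀ i, ∀ x ∈ Y, g i x ∈ Icc (0 : ℝ) 1) {d : ℕ} (hd : 1 ≤ d)
    (hpd : ∀ S : Finset Ω, (S : Set Ω) ⊆ Y → PseudoShatters (Set.range g) S → S.card ≤ d)
    {N : ℕ} (hN : 1 ≤ N) {u : ℝ} (hu : 0 ≤ u) (x : Fin N × Bool → Ω) (hx : ∀ j, x j ∈ Y)
    (B : Finset (Fin N → Bool))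
    (hB : ∀ b ∈ B, ∃ i, 66 * √N * (√d + u) < |signedDiff b (g i ∘ x)|) :
    (B.card : ℝ) ≤ 2 ^ N * Real.exp (-u ^ 2) := by
  classical
  rcases B.eq_empty_or_nonempty with rfl | ⟨b₀, hb₀⟩
  · simp; positivity
  have : Nonempty ι := ⟨(hB b₀ hb₀).choose⟩
  -- One violating function per sign vector suffices, so the chaining bound for finite families
  -- covers an infinite class.
  choose! i hi using hB
  set F : Finset (Fin N × Bool → ℝ) := B.image fun b => g (i b) ∘ x with hF
  have hFsub : (F : Set (Fin N × Bool → ℝ)) ⊆ (fun f => f ∘ x) '' Set.range g := by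
    intro f hf
    obtain ⟨b, -, rfl⟩ := Finset.mem_image.1 hf
    exact ⟨_, ⟨i b, rfl⟩, rfl⟩
  have h := card_exists_lt_abs_signedDiff_le hN hd hu F (fun S hS => by
    obtain ⟨S', hc, hsub, hS'⟩ := PseudoShatters.exists_of_comp _ x (hS.mono hFsub)
    exact hc ▸ hpd S' (hsub.trans (Set.range_subset_iff.2 hx)) hS') (fun f hf j => by
    obtain ⟨b, -, rfl⟩ := Finset.mem_image.1 hf
    exact h01 _ _ (hx j))
  refine le_trans ?_ h
  refine Nat.cast_le.2 (Finset.card_le_card fun b hb => Finset.mem_filter.2 ?_)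
  exact ⟨Finset.mem_univ _, g (i b) ∘ x, Finset.mem_image_of_mem _ hb, hi b hb⟩

/-- Swapping the two members of any of the pairs preserves the product measure. So the measure of
the bad event equals its average over the `2 ^ N` swap patterns, and for almost every fixed double
sample chaining bounds the number of bad patterns. -/
theorem measure_ghost_deviation_le {Ω : Type*} [MeasurableSpace Ω]
    (μ : Measure Ω) [IsProbabilityMeasure μ] {ι : Type*} [Countable ι] {g : ι → Ω → ℝ}
    (hg : ∀ i, Measurable (g i)) {Y : Set Ω} (hY : ∀ᵐ x ∂μ, x ∈ Y)
    (h01 : ∀ i, ∀ x ∈ Y, g i x ∈ Icc (0 : ℝ) 1) {d : ℕ} (hd : 1 ≤ d)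
    (hpd : ∀ S : Finset Ω, (S : Set Ω) ⊆ Y → PseudoShatters (Set.range g) S → S.card ≤ d)
    {N : ℕ} (hN : 1 ≤ N) {u : ℝ} (hu : 0 ≤ u) :
    Measure.pi (fun _ : Fin N => μ.prod μ) {w | ∃ i, 66 * (√d + u) / √N <
        |sampleMean (g i) (fun k => (w k).1) - sampleMean (g i) (fun k => (w k).2)|}
      ≤ ENNReal.ofReal (Real.exp (-u ^ 2)) := by
  classical
  have hN' : (1 : ℝ) ≤ N := by exact_mod_cast hN
  set ν := Measure.pi (fun _ : Fin N => μ.prod μ) with hν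
  set B : Set (Fin N → Ω × Ω) := {w | ∃ i, 66 * (√d + u) / √N <
        |sampleMean (g i) (fun k => (w k).1) - sampleMean (g i) (fun k => (w k).2)|} with hB
  have hmB : MeasurableSet B := by
    rw [hB, ofPred_exists]
    refine MeasurableSet.iUnion fun i => measurableSet_lt measurable_const ?_
    exact (((measurable_sampleMean (hg i)).comp (by fun_prop)).sub
      ((measurable_sampleMean (hg i)).comp (by fun_prop))).norm
  let T : (Fin N → Bool) → (Fin N → Ω × Ω) → (Fin N → Ω × Ω) := fun b w k =>
    (if b k then id else Prod.swap : Ω × Ω → Ω × Ω) (w k)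
  have hT : ∀ b, MeasurePreserving (T b) ν ν := fun b => by
    refine measurePreserving_pi (fun _ : Fin N => μ.prod μ) (fun _ : Fin N => μ.prod μ)
      (f := fun k => (if b k then id else Prod.swap : Ω × Ω → Ω × Ω)) fun k => ?_
    cases b k
    · exact Measure.measurePreserving_swap
    · exact MeasurePreserving.id _
  have hsum : ∑ b : Fin N → Bool, ν (T b ⁻¹' B) = 2 ^ N * ν B := by
    simp only [fun b => (hT b).measure_preimage hmB.nullMeasurableSet]
    simp
  have hYae : ∀ᵐ w ∂ν, ∀ k, (w k).1 ∈ Y ∧ (w k).2 ∈ Y := by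
    rw [ae_all_iff]
    intro k
    have h1 : ∀ᵐ p ∂μ.prod μ, p.1 ∈ Y ∧ p.2 ∈ Y :=
      (Measure.quasiMeasurePreserving_fst.ae hY).and (Measure.quasiMeasurePreserving_snd.ae hY)
    exact (measurePreserving_eval (fun _ : Fin N => μ.prod μ) k).quasiMeasurePreserving.ae h1
  have hpt : ∀ᵐ w ∂ν, ∑ b : Fin N → Bool, (T b ⁻¹' B).indicator (fun _ => (1 : ENNReal)) w
      ≤ ENNReal.ofReal (2 ^ N * Real.exp (-u ^ 2)) := by
    filter_upwards [hYae] with w hw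
    set Bw : Finset (Fin N → Bool) := Finset.univ.filter fun b => T b w ∈ B with hBw
    have h1 : ∑ b : Fin N → Bool, (T b ⁻¹' B).indicator (fun _ => (1 : ENNReal)) w = Bw.card := by
      rw [hBw, Finset.card_filter]
      push_cast
      exact Finset.sum_congr rfl fun b _ => by simp [Set.indicator_apply]
    let x : Fin N × Bool → Ω := fun j => if j.2 then (w j.1).1 else (w j.1).2
    have h2 := card_exists_lt_abs_signedDiff_comp_le h01 hd hpd hN hu x (fun j => by
      by_cases h : j.2 <;> simp only [x, h]
      · exact (hw j.1).1
      · exact (hw j.1).2) Bw (fun b hb => by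
      obtain ⟨i, hi⟩ := (Finset.mem_filter.1 hb).2
      refine ⟨i, ?_⟩
      have h3 : sampleMean (g i) (fun k => (T b w k).1) - sampleMean (g i) (fun k => (T b w k).2)
          = (1 / (N : ℝ)) * signedDiff b (g i ∘ x) := by
        simp only [sampleMean, signedDiff, ← mul_sub, ← Finset.sum_sub_distrib]
        congr 1
        refine Finset.sum_congr rfl fun k _ => ?_
        by_cases h : b k <;> simp [T, x, h, boolSign]
      rw [h3, abs_mul, abs_of_nonneg (by positivity : (0 : ℝ) ≤ 1 / N), div_lt_iff₀ (by positivity)] at hi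
      have h4 : √(N : ℝ) * √N = N := Real.mul_self_sqrt (Nat.cast_nonneg N)
      calc 66 * √N * (√d + u) = √N * (66 * (√d + u)) := by ring
        _ < √N * (1 / N * |signedDiff b (g i ∘ x)| * √N) := by
            apply mul_lt_mul_of_pos_left hi (by positivity)
        _ = (√N * √N) * (1 / N) * |signedDiff b (g i ∘ x)| := by ring
        _ = _ := by rw [h4]; field_simp)
    rw [h1, ← ENNReal.ofReal_natCast]
    exact ENNReal.ofReal_le_ofReal h2
  have hfin : 2 ^ N * ν B ≤ 2 ^ N * ENNReal.ofReal (Real.exp (-u ^ 2)) := by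
    calc 2 ^ N * ν B = ∑ b : Fin N → Bool, ∫⁻ w, (T b ⁻¹' B).indicator (fun _ => (1 : ENNReal)) w ∂ν := by
          rw [← hsum]
          refine Finset.sum_congr rfl fun b _ => ?_
          rw [lintegral_indicator_const ((hT b).measurable hmB), one_mul]
      _ = ∫⁻ w, ∑ b : Fin N → Bool, (T b ⁻¹' B).indicator (fun _ => (1 : ENNReal)) w ∂ν :=
          (lintegral_finsetSum _ fun b _ =>
            measurable_const.indicator ((hT b).measurable hmB)).symm
      _ ≤ ∫⁻ _, ENNReal.ofReal (2 ^ N * Real.exp (-u ^ 2)) ∂ν := lintegral_mono_ae hpt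
      _ = 2 ^ N * ENNReal.ofReal (Real.exp (-u ^ 2)) := by
          rw [lintegral_const, measure_univ, mul_one, ENNReal.ofReal_mul (by positivity),
            ENNReal.ofReal_pow (by norm_num)]
          simp
  exact (ENNReal.mul_le_mul_iff_right (by simp) (by simp)).1 hfin

/-- Uniform convergence for a countable class of functions of pseudo-dimension at most `d`. -/
theorem measure_exists_deviation_le {Ω : Type*} [MeasurableSpace Ω]
    (μ : Measure Ω) [IsProbabilityMeasure μ] {ι : Type*} [Countable ι] {g : ι → Ω → ℝ}
    (hg : ∀ i, Measurable (g i)) {Y : Set Ω} (hY : ∀ᵐ x ∂μ, x ∈ Y)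
    (h01 : ∀ i, ∀ x ∈ Y, g i x ∈ Icc (0 : ℝ) 1) {d : ℕ} (hd : 1 ≤ d)
    (hpd : ∀ S : Finset Ω, (S : Set Ω) ⊆ Y → PseudoShatters (Set.range g) S → S.card ≤ d)
    {N : ℕ} (hN : 1 ≤ N) {u : ℝ} (hu : 0 ≤ u) :
    Measure.pi (fun _ : Fin N => μ) {s | ∃ i, 132 * (√d + u) / √N <
        |sampleMean (g i) s - ∫ x, g i x ∂μ|} ≤ 2 * ENNReal.ofReal (Real.exp (-u ^ 2)) := by
  have hN' : (1 : ℝ) ≤ N := by exact_mod_cast hN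
  have hd1 : 1 ≤ √(d : ℝ) := Real.one_le_sqrt.2 (by exact_mod_cast hd)
  have h := measure_exists_lt_abs_sampleMean_sub_integral_le μ hg
    (fun i => hY.mono fun x hx => h01 i x hx) hN (t := 66 * (√d + u) / √N) (by
      rw [div_mul_cancel₀ _ (by positivity)]; linarith)
  have h2 := measure_ghost_deviation_le μ hg hY h01 hd hpd hN hu
  rw [show 132 * (√d + u) / √N = 2 * (66 * (√d + u) / √N) by ring]
  exact h.trans (by gcongr)

/-! ### Delineability -/

/-- A continuous function without zeros on a preconnected set has constant sign there. -/
theorem IsPreconnected.pos_of_pos {X : Type*} [TopologicalSpace X] {A : Set X}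
    (hA : IsPreconnected A) {h : X → ℝ} (hc : Continuous h) (h0 : ∀ q ∈ A, h q ≠ 0) {p q : X}
    (hp : p ∈ A) (hq : q ∈ A) (hpos : 0 < h p) : 0 < h q := by
  by_contra hle
  obtain ⟨y, hy, hy0⟩ := hA.intermediate_value hq hp hc.continuousOn ⟨not_lt.1 hle, hpos.le⟩
  exact h0 y hy hy0

namespace LotteryMenu

variable {m ℓ : ℕ}

theorem mem_best {M : LotteryMenu m ℓ} {v : Fin m → ℝ} {j : Fin (ℓ + 1)} :
    j ∈ M.best v ↔ ∀ k, M.utility v k ≤ M.utility v j := by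
  classical
  simp [best]

theorem choice_mem_best (τ : LotteryMenu m ℓ → Equiv.Perm (Fin (ℓ + 1))) (M : LotteryMenu m ℓ)
    (v : Fin m → ℝ) : M.choice τ v ∈ M.best v := by
  obtain ⟨j, hj, hj'⟩ := Finset.mem_image.1
    (Finset.min'_mem ((M.best v).image (τ M)) ((M.best_nonempty v).image _))
  rw [choice, ← hj']
  simpa using hj

theorem utility_le_choice (τ : LotteryMenu m ℓ → Equiv.Perm (Fin (ℓ + 1))) (M : LotteryMenu m ℓ)
    (v : Fin m → ℝ) (k : Fin (ℓ + 1)) : M.utility v k ≤ M.utility v (M.choice τ v) :=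
  mem_best.1 (choice_mem_best τ M v) k

/-- A strict maximizer of the utility is chosen, whatever the priority order. -/
theorem choice_eq_of_forall_lt {τ : LotteryMenu m ℓ → Equiv.Perm (Fin (ℓ + 1))}
    {M : LotteryMenu m ℓ} {v : Fin m → ℝ} {j : Fin (ℓ + 1)}
    (h : ∀ k, k ≠ j → M.utility v k < M.utility v j) : M.choice τ v = j := by
  by_contra hne
  exact absurd (utility_le_choice τ M v j) (not_le.2 (h _ hne))

/-- The coefficients of the utility of an entry as a linear function of the parameters. -/
def utilityCoeff (v : Fin m → ℝ) : Fin (ℓ + 1) → Fin (ℓ * (m + 1)) → ℝ :=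
  Fin.cons 0 fun j t => if (finProdFinEquiv.symm t).1 = j then
    (Fin.snoc v (-1) : Fin (m + 1) → ℝ) (finProdFinEquiv.symm t).2 else 0

theorem utilityCoeff_succ (v : Fin m → ℝ) (j k : Fin ℓ) (i : Fin (m + 1)) :
    utilityCoeff v j.succ (finProdFinEquiv (k, i)) =
      if k = j then (Fin.snoc v (-1) : Fin (m + 1) → ℝ) i else 0 := by
  simp [utilityCoeff, -finProdFinEquiv_symm_apply]

theorem utility_ofVector (v : Fin m → ℝ) (y : Fin (ℓ * (m + 1)) → ℝ) (j : Fin (ℓ + 1)) :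
    (ofVector y : LotteryMenu m ℓ).utility v j = ∑ t, utilityCoeff v j t * y t := by
  classical
  refine Fin.cases ?_ (fun j => ?_) j
  · simp [utility, utilityCoeff, φ, p]
  · rw [← finProdFinEquiv.sum_comp, Fintype.sum_prod_type, Finset.sum_eq_single j]
    · rw [Fin.sum_univ_castSucc]
      simp [utility, utilityCoeff_succ, φ, p, ofVector, sub_eq_add_neg]
    · intro k _ hk
      exact Finset.sum_eq_zero fun i _ => by simp [utilityCoeff_succ, hk]
    · simp

/-- The price of a lottery enters its own utility with coefficient `-1` and no other utility. Hence
all coefficient vectors differ, including the zero vector of entry `0`, and every tie locus is a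
genuine hyperplane. -/
theorem utilityCoeff_injective (v : Fin m → ℝ) :
    Function.Injective (utilityCoeff (ℓ := ℓ) v) := by
  have key : ∀ (j : Fin ℓ) (k : Fin (ℓ + 1)),
      utilityCoeff v k (finProdFinEquiv (j, Fin.last m)) = if k = j.succ then -1 else 0 := by
    intro j k
    refine Fin.cases ?_ (fun k => ?_) k
    · simp [utilityCoeff, (Fin.succ_ne_zero j).symm]
    · simp [utilityCoeff_succ, eq_comm]
  have key' : ∀ j k : Fin (ℓ + 1), utilityCoeff v j = utilityCoeff v k → j ≠ 0 → j = k := by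
    intro j k h hj
    obtain ⟨j, rfl⟩ := Fin.exists_succ_eq.2 hj
    have := congrFun h (finProdFinEquiv (j, Fin.last m))
    rw [key, key] at this
    by_contra hne
    simp [Ne.symm hne] at this
  intro j k h
  by_cases hj : j = 0
  · by_cases hk : k = 0
    · rw [hj, hk]
    · exact (key' k j h.symm hk).symm
  · exact key' j k h hj

theorem isHyperplane_utility_eq (v : Fin m → ℝ) {j k : Fin (ℓ + 1)} (hjk : j ≠ k) :
    IsHyperplane {y : Fin (ℓ * (m + 1)) → ℝ |
      (ofVector y : LotteryMenu m ℓ).utility v j = (ofVector y : LotteryMenu m ℓ).utility v k} := by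
  refine ⟨utilityCoeff v j - utilityCoeff v k,
    sub_ne_zero.2 fun h => hjk (utilityCoeff_injective v h), 0, ?_⟩
  ext y
  simp only [mem_ofPred_eq, utility_ofVector, Pi.sub_apply, sub_mul, Finset.sum_sub_distrib,
    sub_eq_zero]

theorem isHyperplane_coord {d : ℕ} (t : Fin d) (r : ℝ) : IsHyperplane {y : Fin d → ℝ | y t = r} := by
  classical
  refine ⟨Pi.single t 1, by simp, r, ?_⟩
  ext y
  simp [Pi.single_apply]

theorem continuous_utility_ofVector (v : Fin m → ℝ) (j : Fin (ℓ + 1)) :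
    Continuous fun y : Fin (ℓ * (m + 1)) → ℝ => (ofVector y : LotteryMenu m ℓ).utility v j := by
  simp only [utility_ofVector]
  fun_prop

/-- Utility differences and `prob j i - z i` are continuous and never vanish on `A`, so their signs
are constant there. The strict maximizer persists, whatever the tie-breaking of each menu, and so
does its bundle; only the price varies. -/
theorem linearOver_profit' (c : Finset (Fin m) → ℝ)
    (τ : LotteryMenu m ℓ → Equiv.Perm (Fin (ℓ + 1))) (v z : Fin m → ℝ)
    {A : Set (Fin (ℓ * (m + 1)) → ℝ)} (hA : IsPreconnected A)
    (hu : ∀ y ∈ A, ∀ j k : Fin (ℓ + 1), j ≠ k →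
      (ofVector y : LotteryMenu m ℓ).utility v j ≠ (ofVector y : LotteryMenu m ℓ).utility v k)
    (hz : ∀ y ∈ A, ∀ (j : Fin ℓ) (i : Fin m), (ofVector y : LotteryMenu m ℓ).prob j i ≠ z i)
    {x : Fin (ℓ * (m + 1)) → ℝ} (hx : x ∈ A) :
    LinearOver (fun q => (ofVector q : LotteryMenu m ℓ).profit' c τ v z) A := by
  classical
  set j := (ofVector x : LotteryMenu m ℓ).choice τ v with hj
  have hchoice : ∀ q ∈ A, (ofVector q : LotteryMenu m ℓ).choice τ v = j := by
    intro q hq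
    refine choice_eq_of_forall_lt fun k hk => sub_pos.1 ?_
    refine hA.pos_of_pos (h := fun y => (ofVector y : LotteryMenu m ℓ).utility v j -
      (ofVector y : LotteryMenu m ℓ).utility v k)
      ((continuous_utility_ofVector v j).sub (continuous_utility_ofVector v k))
      (fun y hy => sub_ne_zero.2 (hu y hy j k hk.symm)) hx hq ?_
    exact sub_pos.2 ((utility_le_choice τ _ v k).lt_of_ne (hu x hx k j hk))
  have hbundle : ∀ q ∈ A, bundle ((ofVector q : LotteryMenu m ℓ).φ j) z
      = bundle ((ofVector x : LotteryMenu m ℓ).φ j) z := by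
    intro q hq
    unfold bundle
    refine Finset.filter_congr fun i _ => ?_
    revert hchoice
    refine Fin.cases ?_ (fun j _ => ?_) j
    · simp [φ]
    · have hc : Continuous fun y : Fin (ℓ * (m + 1)) → ℝ =>
          (ofVector y : LotteryMenu m ℓ).prob j i - z i := by
        simp only [ofVector]; fun_prop
      have := fun {a b} (ha : a ∈ A) (hb : b ∈ A) => hA.pos_of_pos hc
        (fun y hy => sub_ne_zero.2 (hz y hy j i)) ha hb
      simp only [φ, Fin.cons_succ]
      exact ⟨fun h => sub_pos.1 (this hq hx (sub_pos.2 h)),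
        fun h => sub_pos.1 (this hx hq (sub_pos.2 h))⟩
  have hp : ∃ a : Fin (ℓ * (m + 1)) → ℝ, ∀ q, (ofVector q : LotteryMenu m ℓ).p j = ∑ i, a i * q i := by
    clear hchoice hbundle
    refine Fin.cases ⟨0, by simp [p]⟩ (fun j => ?_) j
    exact ⟨Pi.single (finProdFinEquiv (j, Fin.last m)) 1, fun q => by
      simp [p, ofVector, Pi.single_apply]⟩
  obtain ⟨a, ha⟩ := hp
  refine ⟨a, -c (bundle ((ofVector x : LotteryMenu m ℓ).φ j) z), fun q hq => ?_⟩
  simp only [profit']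
  rw [hchoice q hq, hbundle q hq, ha, sub_eq_add_neg]

theorem isDelineable_profit' (b : BuyerType) (c : Finset (Fin m) → ℝ)
    (τ : LotteryMenu m ℓ → Equiv.Perm (Fin (ℓ + 1))) (Y : Set ((Fin m → ℝ) × (Fin m → ℝ))) :
    IsDelineable (ℓ * (m + 1)) ((ℓ + 1) ^ 2 + m * ℓ)
      {x : Fin (ℓ * (m + 1)) → ℝ | (LotteryMenu.ofVector x : LotteryMenu m ℓ).Valid b}
      (fun x vz => (LotteryMenu.ofVector x : LotteryMenu m ℓ).profit' c τ vz.1 vz.2) Y := by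
  classical
  rintro ⟨v, z⟩ -
  -- Ordered pairs of entries are counted, each tie locus twice; this crude count already fits into
  -- `(ℓ + 1) ^ 2`.
  let 𝓗₁ : Finset (Set (Fin (ℓ * (m + 1)) → ℝ)) :=
    (Finset.univ.filter fun q : Fin (ℓ + 1) × Fin (ℓ + 1) => q.1 ≠ q.2).image fun q =>
      {y | (ofVector y : LotteryMenu m ℓ).utility v q.1 = (ofVector y : LotteryMenu m ℓ).utility v q.2}
  let 𝓗₂ : Finset (Set (Fin (ℓ * (m + 1)) → ℝ)) :=
    (Finset.univ : Finset (Fin ℓ × Fin m)).image fun q =>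
      {y | y (finProdFinEquiv (q.1, q.2.castSucc)) = z q.2}
  refine ⟨𝓗₁ ∪ 𝓗₂, ?_, ?_, fun p hp => ?_⟩
  · refine (Finset.card_union_le _ _).trans (add_le_add ?_ ?_)
    · refine Finset.card_image_le.trans ((Finset.card_filter_le _ _).trans ?_)
      simp [sq]
    · refine Finset.card_image_le.trans ?_
      simp [mul_comm]
  · intro H hH
    rcases Finset.mem_union.1 hH with hH | hH
    · obtain ⟨q, hq, rfl⟩ := Finset.mem_image.1 hH
      exact isHyperplane_utility_eq v (Finset.mem_filter.1 hq).2
    · obtain ⟨q, -, rfl⟩ := Finset.mem_image.1 hH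
      exact isHyperplane_coord _ _
  · have hsub := connectedComponentIn_subset
      ({x : Fin (ℓ * (m + 1)) → ℝ | (LotteryMenu.ofVector x : LotteryMenu m ℓ).Valid b} \
        ⋃ H ∈ 𝓗₁ ∪ 𝓗₂, H) p
    refine linearOver_profit' c τ v z isPreconnected_connectedComponentIn ?_ ?_
      (mem_connectedComponentIn hp)
    · intro y hy j k hjk heq
      refine (hsub hy).2 (mem_iUnion₂.2 ⟨_, Finset.mem_union_left _
        (Finset.mem_image_of_mem _ (Finset.mem_filter.2 ⟨Finset.mem_univ (j, k), hjk⟩)), heq⟩)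
    · intro y hy j i heq
      exact (hsub hy).2 (mem_iUnion₂.2 ⟨_, Finset.mem_union_right _
        (Finset.mem_image_of_mem _ (Finset.mem_univ (j, i))), heq⟩)

end LotteryMenu

/-! ### Measurability and integrals of the profit -/

/-- The probability that exactly the items in `S` are allocated, when item `i` is allocated with
probability `φ i`, independently of the other items. -/
def bundleProb {m : ℕ} (φ : Fin m → ℝ) (S : Finset (Fin m)) : ℝ :=
  (∏ i ∈ S, φ i) * ∏ i ∈ Sᶜ, (1 - φ i)

instance instIsProbabilityMeasureUniformCube (m : ℕ) : IsProbabilityMeasure (uniformCube m) :=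
  ⟨by simp [uniformCube, Real.volume_Icc_pi]⟩

theorem uniformCube_eq_pi (m : ℕ) :
    uniformCube m = Measure.pi fun _ : Fin m => (volume : Measure ℝ).restrict (Icc 0 1) := by
  rw [uniformCube, ← Set.pi_univ_Icc, volume_pi, Measure.restrict_pi_pi]
  rfl

theorem ae_uniformCube_mem_Icc (m : ℕ) : ∀ᵐ z ∂uniformCube m, z ∈ Icc (0 : Fin m → ℝ) 1 :=
  ae_restrict_mem measurableSet_Icc

namespace LotteryMenu

variable {m ℓ : ℕ}

theorem mem_bundle {φ z : Fin m → ℝ} {i : Fin m} : i ∈ bundle φ z ↔ z i < φ i := by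
  classical
  simp [bundle]

theorem setOf_bundle_eq (φ : Fin m → ℝ) (S : Finset (Fin m)) :
    {z | bundle φ z = S} = Set.pi Set.univ fun i => open Classical in
      if i ∈ S then Iio (φ i) else Ici (φ i) := by
  classical
  ext z
  simp only [mem_ofPred_eq, Finset.ext_iff, mem_bundle, Set.mem_pi, Set.mem_univ, true_implies]
  refine forall_congr' fun i => ?_
  by_cases h : i ∈ S <;> simp [h]

theorem measurableSet_bundle_eq (φ : Fin m → ℝ) (S : Finset (Fin m)) :
    MeasurableSet {z | bundle φ z = S} := by
  classical
  rw [setOf_bundle_eq]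
  refine MeasurableSet.univ_pi fun i => ?_
  split_ifs
  · exact measurableSet_Iio
  · exact measurableSet_Ici

theorem apply_bundle_eq_sum (c : Finset (Fin m) → ℝ) (φ z : Fin m → ℝ) :
    c (bundle φ z) = ∑ S, {z | bundle φ z = S}.indicator (fun _ => c S) z := by
  classical
  rw [Finset.sum_eq_single (bundle φ z)]
  · simp
  · intro S _ hS
    simp [Ne.symm hS]
  · simp

theorem measurable_apply_bundle (c : Finset (Fin m) → ℝ) (φ : Fin m → ℝ) :
    Measurable fun z => c (bundle φ z) := by
  simp only [apply_bundle_eq_sum c φ]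
  exact Finset.measurable_sum _ fun S _ => measurable_const.indicator (measurableSet_bundle_eq φ S)

/-- The event is a box, so under the product measure its probability is the product of the lengths
`φ i` and `1 - φ i` of its sides within `[0,1]`. -/
theorem measureReal_bundle_eq {φ : Fin m → ℝ} (hφ : ∀ i, 0 ≤ φ i ∧ φ i ≤ 1) (S : Finset (Fin m)) :
    (uniformCube m).real {z | bundle φ z = S} = bundleProb φ S := by
  classical
  rw [setOf_bundle_eq, measureReal_def, uniformCube_eq_pi, Measure.pi_pi, ENNReal.toReal_prod,
    bundleProb, ← Finset.prod_mul_prod_compl S]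
  congr 1
  · refine Finset.prod_congr rfl fun i hi => ?_
    rw [if_pos hi, Measure.restrict_apply measurableSet_Iio]
    have : Iio (φ i) ∩ Icc 0 1 = Ico 0 (φ i) := by
      ext x
      simp only [mem_inter_iff, mem_Iio, mem_Icc, mem_Ico]
      constructor
      · rintro ⟨h1, h2, -⟩; exact ⟨h2, h1⟩
      · rintro ⟨h1, h2⟩; exact ⟨h2, h1, h2.le.trans (hφ i).2⟩
    rw [this, Real.volume_Ico, sub_zero, ENNReal.toReal_ofReal (hφ i).1]
  · refine Finset.prod_congr rfl fun i hi => ?_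
    rw [if_neg (Finset.mem_compl.1 hi), Measure.restrict_apply measurableSet_Ici]
    have : Ici (φ i) ∩ Icc 0 1 = Icc (φ i) 1 := by
      ext x
      simp only [mem_inter_iff, mem_Ici, mem_Icc]
      constructor
      · rintro ⟨h1, -, h2⟩; exact ⟨h1, h2⟩
      · rintro ⟨h1, h2⟩; exact ⟨h1, (hφ i).1.trans h1, h2⟩
    rw [this, Real.volume_Icc, ENNReal.toReal_ofReal (sub_nonneg.2 (hφ i).2)]

theorem integral_apply_bundle (c : Finset (Fin m) → ℝ) {φ : Fin m → ℝ}
    (hφ : ∀ i, 0 ≤ φ i ∧ φ i ≤ 1) :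
    ∫ z, c (bundle φ z) ∂uniformCube m = ∑ S, bundleProb φ S * c S := by
  simp only [apply_bundle_eq_sum c φ]
  rw [integral_finsetSum _ fun S _ =>
    (integrable_const (c S)).indicator (measurableSet_bundle_eq φ S)]
  refine Finset.sum_congr rfl fun S _ => ?_
  rw [integral_indicator_const _ (measurableSet_bundle_eq φ S), measureReal_bundle_eq hφ, smul_eq_mul]

/-- The expected number of allocated copies of item `i`. -/
theorem sum_bundleProb_mem (φ : Fin m → ℝ) (i : Fin m) :
    ∑ S, (if i ∈ S then bundleProb φ S else 0) = φ i := by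
  classical
  -- Expanding the product over all `S` with `1 - φ i` replaced by `0` kills the sets that omit `i`;
  -- in factored form every factor except `φ i` equals `1`.
  have h := Fintype.prod_add φ (fun k => if k = i then 0 else 1 - φ k)
  have h1 : ∏ k, (φ k + if k = i then 0 else 1 - φ k) = φ i := by
    rw [Finset.prod_eq_single i]
    · simp
    · intro k _ hk
      simp [hk]
    · simp
  rw [← h1, h]
  refine Finset.sum_congr rfl fun S _ => ?_
  split_ifs with hi
  · rw [bundleProb]
    congr 1
    refine Finset.prod_congr rfl fun k hk => ?_
    rw [if_neg]
    rintro rfl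
    exact Finset.mem_compl.1 hk hi
  · rw [Finset.prod_eq_zero (Finset.mem_compl.2 hi) (by simp), mul_zero]

/-- Linearity of expectation: an additive cost depends only on the marginal probabilities, so
independent and single-item allocation have the same expected cost. -/
theorem sum_bundleProb_mul_of_additiveCost {c : Finset (Fin m) → ℝ} (hc : AdditiveCost c)
    (φ : Fin m → ℝ) : ∑ S, bundleProb φ S * c S = ∑ i, φ i * c {i} := by
  classical
  calc ∑ S, bundleProb φ S * c S
      = ∑ S, ∑ i, (if i ∈ S then bundleProb φ S else 0) * c {i} := by
        refine Finset.sum_congr rfl fun S _ => ?_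
        rw [hc S, Finset.mul_sum]
        simp [ite_mul, Finset.sum_ite_mem]
    _ = ∑ i, ∑ S, (if i ∈ S then bundleProb φ S else 0) * c {i} := Finset.sum_comm
    _ = _ := Finset.sum_congr rfl fun i _ => by rw [← Finset.sum_mul, sum_bundleProb_mem]

theorem profit_eq (c : Finset (Fin m) → ℝ) (τ : LotteryMenu m ℓ → Equiv.Perm (Fin (ℓ + 1)))
    (M : LotteryMenu m ℓ) (v : Fin m → ℝ) : M.profit c τ v =
      M.p (M.choice τ v) - ∑ S, bundleProb (M.φ (M.choice τ v)) S * c S := rfl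

theorem singleItemProfit_eq_profit {c : Finset (Fin m) → ℝ} (hc : AdditiveCost c)
    (τ : LotteryMenu m ℓ → Equiv.Perm (Fin (ℓ + 1))) (M : LotteryMenu m ℓ) (v : Fin m → ℝ) :
    M.singleItemProfit c τ v = M.profit c τ v := by
  rw [profit_eq, sum_bundleProb_mul_of_additiveCost hc, singleItemProfit,
    show c ∅ = 0 by rw [hc ∅, Finset.sum_empty], mul_zero, add_zero]

theorem choice_eq_iff {τ : LotteryMenu m ℓ → Equiv.Perm (Fin (ℓ + 1))} {M : LotteryMenu m ℓ}
    {v : Fin m → ℝ} {j : Fin (ℓ + 1)} :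
    M.choice τ v = j ↔ j ∈ M.best v ∧ ∀ k ∈ M.best v, τ M j ≤ τ M k := by
  have hmin : ∀ k ∈ M.best v, τ M (M.choice τ v) ≤ τ M k := fun k hk => by
    rw [choice, Equiv.apply_symm_apply]
    exact Finset.min'_le _ _ (Finset.mem_image_of_mem _ hk)
  constructor
  · rintro rfl
    exact ⟨choice_mem_best τ M v, hmin⟩
  · rintro ⟨h1, h2⟩
    exact (τ M).injective (le_antisymm (hmin j h1) (h2 _ (choice_mem_best τ M v)))

theorem measurable_utility (M : LotteryMenu m ℓ) (j : Fin (ℓ + 1)) :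
    Measurable fun v => M.utility v j := by
  unfold utility
  fun_prop

/-- For a fixed menu the priority order is fixed, and the finitely many level sets are Boolean
combinations of inequalities between utilities. -/
theorem measurable_choice (τ : LotteryMenu m ℓ → Equiv.Perm (Fin (ℓ + 1))) (M : LotteryMenu m ℓ) :
    Measurable (M.choice τ) := by
  have hbest : ∀ j, MeasurableSet {v | j ∈ M.best v} := fun j => by
    simp only [mem_best, ofPred_forall]
    exact MeasurableSet.iInter fun k =>
      measurableSet_le (M.measurable_utility k) (M.measurable_utility j)
  refine measurable_to_countable' fun j => ?_
  have : M.choice τ ⁻¹' {j} = {v | j ∈ M.best v} ∩ ⋂ k, {v | k ∈ M.best v → τ M j ≤ τ M k} := by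
    ext v
    simp [choice_eq_iff]
  rw [this]
  refine (hbest j).inter (MeasurableSet.iInter fun k => ?_)
  by_cases h : τ M j ≤ τ M k
  · simp [h]
  · have hk : {v | k ∈ M.best v → τ M j ≤ τ M k} = {v | k ∈ M.best v}ᶜ := by
      ext v
      simp [h]
    rw [hk]
    exact (hbest k).compl

theorem measurable_profit' (c : Finset (Fin m) → ℝ)
    (τ : LotteryMenu m ℓ → Equiv.Perm (Fin (ℓ + 1))) (M : LotteryMenu m ℓ) :
    Measurable fun x : (Fin m → ℝ) × (Fin m → ℝ) => M.profit' c τ x.1 x.2 := by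
  have h : Measurable fun y : Fin (ℓ + 1) × (Fin m → ℝ) => M.p y.1 - c (bundle (M.φ y.1) y.2) :=
    measurable_from_prod_countable_right fun j =>
      measurable_const.sub (measurable_apply_bundle c (M.φ j))
  exact h.comp (((measurable_choice τ M).comp measurable_fst).prodMk measurable_snd)

theorem abs_profit'_le (c : Finset (Fin m) → ℝ) (τ : LotteryMenu m ℓ → Equiv.Perm (Fin (ℓ + 1)))
    (M : LotteryMenu m ℓ) (v z : Fin m → ℝ) :
    |M.profit' c τ v z| ≤ ∑ j, |M.p j| + ∑ S, |c S| := by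
  refine (abs_sub _ _).trans (add_le_add ?_ ?_)
  · exact Finset.single_le_sum (f := fun j => |M.p j|) (fun _ _ => abs_nonneg _) (Finset.mem_univ _)
  · exact Finset.single_le_sum (f := fun S => |c S|) (fun _ _ => abs_nonneg _) (Finset.mem_univ _)

theorem integrable_profit' (c : Finset (Fin m) → ℝ)
    (τ : LotteryMenu m ℓ → Equiv.Perm (Fin (ℓ + 1))) (M : LotteryMenu m ℓ)
    (μ : Measure ((Fin m → ℝ) × (Fin m → ℝ))) [IsFiniteMeasure μ] :
    Integrable (fun x : (Fin m → ℝ) × (Fin m → ℝ) => M.profit' c τ x.1 x.2) μ :=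
  Integrable.of_bound (M.measurable_profit' c τ).aestronglyMeasurable _
    (Filter.Eventually.of_forall fun x => M.abs_profit'_le c τ x.1 x.2)

theorem Valid.φ_mem {b : BuyerType} {M : LotteryMenu m ℓ} (hM : M.Valid b) (j : Fin (ℓ + 1))
    (i : Fin m) : 0 ≤ M.φ j i ∧ M.φ j i ≤ 1 := by
  refine Fin.cases ?_ (fun j => ?_) j
  · simp [φ]
  · simpa [φ] using hM.1 j i

/-- The derandomized profit has the right expectation. -/
theorem integral_profit' {b : BuyerType} (c : Finset (Fin m) → ℝ)
    (τ : LotteryMenu m ℓ → Equiv.Perm (Fin (ℓ + 1))) {M : LotteryMenu m ℓ} (hM : M.Valid b)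
    (D : Measure (Fin m → ℝ)) [IsProbabilityMeasure D] :
    ∫ x, M.profit' c τ x.1 x.2 ∂D.prod (uniformCube m) = ∫ v, M.profit c τ v ∂D := by
  rw [integral_prod _ (M.integrable_profit' c τ _)]
  refine integral_congr_ae (Filter.Eventually.of_forall fun v => ?_)
  simp only [profit', profit_eq]
  rw [integral_sub (integrable_const _), integral_apply_bundle c (hM.φ_mem _)]
  · simp
  · exact Integrable.of_bound (measurable_apply_bundle c _).aestronglyMeasurable (∑ S, |c S|)
      (Filter.Eventually.of_forall fun z => Finset.single_le_sum (f := fun S => |c S|)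
        (fun _ _ => abs_nonneg _) (Finset.mem_univ _))

end LotteryMenu

/-! ### Perturbed menus -/

namespace LotteryMenu

variable {m ℓ : ℕ}

/-- The menus `M' k` approximate `M` with all prices of the seller's entries lowered by `a`: the
probabilities are approached from below, and the prices carry a bonus of order `1 / (k + 1)` that
breaks ties according to the priority order `σ`, however ties are broken in `M' k`. -/
structure IsPerturbation (σ : Equiv.Perm (Fin (ℓ + 1))) (a : ℝ) (M : LotteryMenu m ℓ)
    (M' : ℕ → LotteryMenu m ℓ) : Prop where
  prob_le : ∀ (k : ℕ) j i, (M' k).prob j i ≤ M.prob j i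
  le_prob : ∀ (k : ℕ) j i, M.prob j i - 1 / ((k : ℝ) + 1) ^ 2 ≤ (M' k).prob j i
  abs_price_le : ∀ (k : ℕ) j, |(M' k).price j - (M.price j - a +
    ((σ j.succ : ℕ) - (σ 0 : ℕ) : ℝ) / ((k : ℝ) + 1))| ≤ 1 / ((k : ℝ) + 1) ^ 2

theorem tendsto_one_div_add_one_sq :
    Tendsto (fun k : ℕ => 1 / ((k : ℝ) + 1) ^ 2) atTop (𝓝 0) := by
  simpa using (tendsto_one_div_add_atTop_nhds_zero_nat (𝕜 := ℝ)).pow 2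

variable {σ : Equiv.Perm (Fin (ℓ + 1))} {a : ℝ} {M : LotteryMenu m ℓ} {M' : ℕ → LotteryMenu m ℓ}

/-- Entry `0` has a fixed price, so ranks are measured relative to that of entry `0`; one formula
then covers all entries, with an error of smaller order than the bonus. -/
theorem IsPerturbation.abs_utility_sub_le (h : IsPerturbation σ a M M') (v : Fin m → ℝ) (k : ℕ)
    (j : Fin (ℓ + 1)) :
    |(M' k).utility v j - (M.utility v j + (if j = 0 then 0 else a) -
      ((σ j : ℕ) - (σ 0 : ℕ) : ℝ) / ((k : ℝ) + 1))| ≤ (∑ i, |v i| + 1) * (1 / ((k : ℝ) + 1) ^ 2) := by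
  refine Fin.cases ?_ (fun j => ?_) j
  · simp only [utility, φ, p, Fin.cons_zero, Pi.zero_apply, mul_zero, Finset.sum_const_zero, if_true,
      sub_self, zero_div, add_zero, abs_zero]
    have : 0 ≤ ∑ i, |v i| := Finset.sum_nonneg fun _ _ => abs_nonneg _
    positivity
  · simp only [utility, φ, p, Fin.cons_succ, Fin.succ_ne_zero, if_false]
    have h1 : |∑ i, v i * (M' k).prob j i - ∑ i, v i * M.prob j i|
        ≤ (∑ i, |v i|) * (1 / ((k : ℝ) + 1) ^ 2) := by
      rw [← Finset.sum_sub_distrib, Finset.sum_mul]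
      refine (Finset.abs_sum_le_sum_abs _ _).trans (Finset.sum_le_sum fun i _ => ?_)
      rw [← mul_sub, abs_mul]
      refine mul_le_mul_of_nonneg_left (abs_le.2 ⟨?_, ?_⟩) (abs_nonneg _)
      · linarith [h.le_prob k j i]
      · have : 0 ≤ 1 / ((k : ℝ) + 1) ^ 2 := by positivity
        linarith [h.prob_le k j i]
    have h2 := h.abs_price_le k j
    rw [abs_le] at h1 h2 ⊢
    constructor <;> linarith [h1.1, h1.2, h2.1, h2.2]

/-- A strict utility gap survives small perturbations. At a tie, the ranks differ by at least one,
and the resulting bonus of order `1 / (k + 1)` beats the error of order `1 / (k + 1) ^ 2`. The price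
cut favours only the seller's entries, so it cannot harm the chosen entry unless that is entry `0`
and `a > 0`, which `hv` excludes. -/
theorem IsPerturbation.eventually_choice_eq {τ : LotteryMenu m ℓ → Equiv.Perm (Fin (ℓ + 1))}
    (h : IsPerturbation (τ M) a M M') (ha : 0 ≤ a) {v : Fin m → ℝ}
    (hv : a = 0 ∨ M.choice τ v ≠ 0) : ∀ᶠ k in atTop, (M' k).choice τ v = M.choice τ v := by
  set j := M.choice τ v with hj
  obtain ⟨hbest, hprio⟩ := choice_eq_iff.1 hj.symm
  have hall : ∀ i, i ≠ j → ∀ᶠ k in atTop, (M' k).utility v i < (M' k).utility v j := by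
    intro i hij
    set A : Fin (ℓ + 1) → ℝ := fun j => if j = 0 then 0 else a with hA
    have hAle : A i ≤ A j := by
      rcases hv with rfl | hv
      · simp [hA]
      · simp only [hA, if_neg hv]
        split_ifs <;> linarith
    have hu : M.utility v i ≤ M.utility v j := mem_best.1 hbest i
    set L := ∑ i, |v i| + 1 with hL
    set g := (M.utility v j + A j) - (M.utility v i + A i) with hg
    set r : ℝ := ((τ M i : ℕ) : ℝ) - ((τ M j : ℕ) : ℝ) with hr
    have hlow : ∀ k : ℕ, g + r / ((k : ℝ) + 1) - 2 * L * (1 / ((k : ℝ) + 1) ^ 2)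
        ≤ (M' k).utility v j - (M' k).utility v i := by
      intro k
      have h1 := (abs_le.1 (h.abs_utility_sub_le v k i)).2
      have h2 := (abs_le.1 (h.abs_utility_sub_le v k j)).1
      have h3 : r / ((k : ℝ) + 1) = (((τ M i : ℕ) : ℝ) - ((τ M 0 : ℕ) : ℝ)) / ((k : ℝ) + 1) -
          (((τ M j : ℕ) : ℝ) - ((τ M 0 : ℕ) : ℝ)) / ((k : ℝ) + 1) := by
        rw [← sub_div, hr]; congr 1; ring
      rw [h3]
      simp only [hg, hA]
      linarith
    have hdiv : Tendsto (fun k : ℕ => 1 / ((k : ℝ) + 1)) atTop (𝓝 0) :=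
      tendsto_one_div_add_atTop_nhds_zero_nat
    rcases (show 0 ≤ g by simp only [hg]; linarith).lt_or_eq with hpos | hzero
    · have hlim : Tendsto (fun k : ℕ => g + r / ((k : ℝ) + 1) - 2 * L * (1 / ((k : ℝ) + 1) ^ 2))
          atTop (𝓝 (g + r * 0 - 2 * L * 0)) := by
        refine (tendsto_const_nhds.add ?_).sub (tendsto_one_div_add_one_sq.const_mul _)
        simpa only [div_eq_mul_one_div r] using hdiv.const_mul r
      filter_upwards [hlim.eventually (lt_mem_nhds (show 0 < g + r * 0 - 2 * L * 0 by linarith))] with k hk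
      linarith [hlow k]
    · have hui : i ∈ M.best v := mem_best.2 fun k => (mem_best.1 hbest k).trans (by linarith)
      have hlt : τ M j < τ M i :=
        lt_of_le_of_ne (hprio i hui) fun h => hij ((τ M).injective h).symm
      have hr1 : 1 ≤ r := by
        have : ((τ M j : ℕ) : ℝ) + 1 ≤ ((τ M i : ℕ) : ℝ) := by exact_mod_cast hlt
        linarith
      have hlim : Tendsto (fun k : ℕ => 1 - 2 * L * (1 / ((k : ℝ) + 1)))
          atTop (𝓝 (1 - 2 * L * 0)) := tendsto_const_nhds.sub (hdiv.const_mul _)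
      filter_upwards [hlim.eventually (lt_mem_nhds (show 0 < 1 - 2 * L * 0 by linarith))] with k hk
      have hk1 : (0 : ℝ) < 1 / ((k : ℝ) + 1) := by positivity
      have h4 := hlow k
      have h5 : r / ((k : ℝ) + 1) - 2 * L * (1 / ((k : ℝ) + 1) ^ 2)
          = (r - 2 * L * (1 / ((k : ℝ) + 1))) * (1 / ((k : ℝ) + 1)) := by
        field_simp
      have h6 : 0 < (r - 2 * L * (1 / ((k : ℝ) + 1))) * (1 / ((k : ℝ) + 1)) :=
        mul_pos (by linarith) hk1
      linarith
  have hall' : ∀ᶠ k in atTop, ∀ i, i ≠ j → (M' k).utility v i < (M' k).utility v j := by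
    rw [eventually_all]
    intro i
    by_cases hij : i = j
    · exact Eventually.of_forall fun _ h => absurd hij h
    · exact (hall i hij).mono fun k hk _ => hk
  exact hall'.mono fun k hk => choice_eq_of_forall_lt hk

/-- The profit of the perturbed menus converges at every point. -/
theorem IsPerturbation.tendsto_profit' {τ : LotteryMenu m ℓ → Equiv.Perm (Fin (ℓ + 1))}
    (h : IsPerturbation (τ M) a M M') (c : Finset (Fin m) → ℝ) (ha : 0 ≤ a) {v : Fin m → ℝ}
    (hv : a = 0 ∨ M.choice τ v ≠ 0) (z : Fin m → ℝ) :
    Tendsto (fun k => (M' k).profit' c τ v z) atTop (𝓝 (M.profit' c τ v z - a)) := by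
  have hch := h.eventually_choice_eq ha hv
  set j := M.choice τ v with hj
  have hdiv : Tendsto (fun k : ℕ => 1 / ((k : ℝ) + 1)) atTop (𝓝 0) :=
    tendsto_one_div_add_atTop_nhds_zero_nat
  have hprice : Tendsto (fun k => (M' k).p j) atTop (𝓝 (M.p j - a)) := by
    revert hv
    clear hch hj
    refine Fin.cases (fun hv => ?_) (fun j _ => ?_) j
    · simp [p, hv.resolve_right (by simp)]
    · simp only [p, Fin.cons_succ]
      have h1 : Tendsto (fun k => (M' k).price j - (M.price j - a +
          (((τ M j.succ : ℕ) : ℝ) - ((τ M 0 : ℕ) : ℝ)) / ((k : ℝ) + 1))) atTop (𝓝 0) :=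
        squeeze_zero_norm (fun k => h.abs_price_le k j) tendsto_one_div_add_one_sq
      have h2 := h1.add ((hdiv.const_mul
        (((τ M j.succ : ℕ) : ℝ) - ((τ M 0 : ℕ) : ℝ))).const_add (M.price j - a))
      simp only [mul_zero, add_zero, zero_add] at h2
      refine h2.congr fun k => ?_
      ring
  -- Approach from below is essential: `z i < φ i` is an open condition and persists eventually,
  -- while `φ i ≤ z i` persists because the approximants are no larger.
  have hbundle : ∀ᶠ k in atTop, bundle ((M' k).φ j) z = bundle (M.φ j) z := by
    have : ∀ i, ∀ᶠ k in atTop, (z i < (M' k).φ j i ↔ z i < M.φ j i) := by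
      intro i
      clear hch hj hprice hv
      refine Fin.cases ?_ (fun j => ?_) j
      · simp [φ]
      · simp only [φ, Fin.cons_succ]
        by_cases hz : z i < M.prob j i
        · have h1 : Tendsto (fun k : ℕ => M.prob j i - 1 / ((k : ℝ) + 1) ^ 2) atTop
              (𝓝 (M.prob j i - 0)) := tendsto_const_nhds.sub tendsto_one_div_add_one_sq
          filter_upwards [h1.eventually (lt_mem_nhds (by rwa [sub_zero]))] with k hk
          exact iff_of_true (hk.trans_le (h.le_prob k j i)) hz
        · exact Eventually.of_forall fun k =>
            iff_of_false (fun h' => hz (h'.trans_le (h.prob_le k j i))) hz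
    filter_upwards [eventually_all.2 this] with k hk
    ext i
    simp only [mem_bundle, hk i]
  have hlim : Tendsto (fun k => (M' k).p j - c (bundle (M.φ j) z)) atTop
      (𝓝 (M.p j - a - c (bundle (M.φ j) z))) := hprice.sub tendsto_const_nhds
  rw [show M.profit' c τ v z - a = M.p j - a - c (bundle (M.φ j) z) by
    simp only [profit', ← hj]; ring]
  refine hlim.congr' ?_
  filter_upwards [hch, hbundle] with k h1 h2
  simp only [profit', h1, h2]

/-- The menu with all prices lowered by `a`, with a bonus that breaks ties. -/
def shift (σ : Equiv.Perm (Fin (ℓ + 1))) (a : ℝ) (M : LotteryMenu m ℓ) (k : ℕ) :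
    LotteryMenu m ℓ where
  prob := M.prob
  price j := M.price j - a + ((σ j.succ : ℕ) - (σ 0 : ℕ) : ℝ) / ((k : ℝ) + 1)

theorem isPerturbation_shift (σ : Equiv.Perm (Fin (ℓ + 1))) (a : ℝ) (M : LotteryMenu m ℓ) :
    IsPerturbation σ a M (M.shift σ a) where
  prob_le _ _ _ := le_rfl
  le_prob k j i := sub_le_self _ (by positivity)
  abs_price_le k j := by
    simp only [shift, sub_self, abs_zero]
    positivity

theorem Valid.shift {b : BuyerType} (hM : M.Valid b) (σ : Equiv.Perm (Fin (ℓ + 1))) (a : ℝ)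
    (k : ℕ) : (M.shift σ a k).Valid b := hM

/-- The menu with given rational parameters. -/
def ofRat (q : (Fin ℓ → Fin m → ℚ) × (Fin ℓ → ℚ)) : LotteryMenu m ℓ where
  prob j i := q.1 j i
  price j := q.2 j

theorem exists_rat_near_below {x e : ℝ} (hx : 0 ≤ x) (he : 0 < e) :
    ∃ y : ℚ, 0 ≤ (y : ℝ) ∧ (y : ℝ) ≤ x ∧ x - e ≤ y := by
  rcases hx.eq_or_lt with rfl | hx
  · exact ⟨0, by simp, by simp, by simpa using he.le⟩
  · obtain ⟨y, h1, h2⟩ := exists_rat_btwn (max_lt hx (sub_lt_self x he))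
    exact ⟨y, (le_max_left _ _).trans h1.le, h2.le, (le_max_right _ _).trans h1.le⟩

theorem exists_rat_abs_sub_le (x : ℝ) {e : ℝ} (he : 0 < e) : ∃ y : ℚ, |(y : ℝ) - x| ≤ e := by
  obtain ⟨y, h1, h2⟩ := exists_rat_btwn (sub_lt_self x he)
  exact ⟨y, abs_le.2 ⟨by linarith, by linarith⟩⟩

/-- Every valid menu can be approximated by valid menus with rational parameters. -/
theorem Valid.exists_isPerturbation_ofRat {b : BuyerType} (hM : M.Valid b)
    (σ : Equiv.Perm (Fin (ℓ + 1))) : ∃ q : ℕ → (Fin ℓ → Fin m → ℚ) × (Fin ℓ → ℚ),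
      (∀ k, (ofRat (q k)).Valid b) ∧ IsPerturbation σ 0 M fun k => ofRat (q k) := by
  have hpos : ∀ k : ℕ, 0 < 1 / ((k : ℝ) + 1) ^ 2 := fun k => by positivity
  choose y hy0 hyle hley using fun (k : ℕ) j i => exists_rat_near_below (hM.1 j i).1 (hpos k)
  choose w hw using fun (k : ℕ) j => exists_rat_abs_sub_le
    (M.price j - 0 + ((σ j.succ : ℕ) - (σ 0 : ℕ) : ℝ) / ((k : ℝ) + 1)) (hpos k)
  refine ⟨fun k => (y k, w k), fun k => ⟨fun j i => ⟨hy0 k j i, (hyle k j i).trans (hM.1 j i).2⟩,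
    fun hb j => (Finset.sum_le_sum fun i _ => hyle k j i).trans (hM.2 hb j)⟩, hyle, hley, hw⟩

end LotteryMenu

/-! ### The pseudo-dimension of normalized profits -/

/-- A class shatters every finite set that its pointwise limits shatter. -/
theorem PseudoShatters.of_tendsto {α : Type*} {F G : Set (α → ℝ)} {S : Finset α}
    (hG : ∀ g ∈ G, ∃ f : ℕ → α → ℝ, (∀ n, f n ∈ F) ∧ ∀ x ∈ S, Tendsto (fun n => f n x) atTop (𝓝 (g x)))
    (hS : PseudoShatters G S) : PseudoShatters F S := by
  classical
  obtain ⟨r, hr⟩ := hS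
  choose! g hgG hg using hr
  -- Only the values outside the pattern lie strictly on their side of `r x`. As there are finitely
  -- many patterns, the threshold can be lowered slightly so that all inequalities become strict and
  -- pass to the approximating functions.
  have hr' : ∀ x, ∃ s < r x, ∀ T ∈ S.powerset, x ∈ S → x ∉ T → g T x < s := by
    intro x
    have h1 : ∀ᶠ s in 𝓝[<] r x, ∀ T ∈ S.powerset, x ∈ S → x ∉ T → g T x < s := by
      rw [Finset.eventually_all]
      intro T hT
      by_cases hx : x ∈ S ∧ x ∉ T
      · have hlt : g T x < r x :=
          not_le.1 fun h => hx.2 ((hg T (Finset.mem_powerset.1 hT) x hx.1).1 h)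
        exact ((lt_mem_nhds hlt).filter_mono nhdsWithin_le_nhds).mono fun s hs _ _ => hs
      · exact Eventually.of_forall fun s h2 h3 => absurd ⟨h2, h3⟩ hx
    obtain ⟨s, hs, hs'⟩ := (h1.and self_mem_nhdsWithin).exists
    exact ⟨s, hs', hs⟩
  choose r' hr'lt hr' using hr'
  refine ⟨r', fun T hT => ?_⟩
  obtain ⟨f, hfF, hf⟩ := hG _ (hgG T hT)
  have hev : ∀ᶠ n in atTop, ∀ x ∈ S, (r' x ≤ f n x ↔ x ∈ T) := by
    rw [Finset.eventually_all]
    intro x hx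
    by_cases hxT : x ∈ T
    · filter_upwards [(hf x hx).eventually
        (lt_mem_nhds ((hr'lt x).trans_le ((hg T hT x hx).2 hxT)))] with n hn
      exact iff_of_true hn.le hxT
    · filter_upwards [(hf x hx).eventually
        (gt_mem_nhds (hr' x T (Finset.mem_powerset.2 hT) hx hxT))] with n hn
      exact iff_of_false (not_le.2 hn) hxT
  obtain ⟨n, hn⟩ := hev.exists
  exact ⟨f n, hfF n, hn⟩

theorem PseudoShatters.card_le_of_pseudoDim_eq {α : Type*} {F : Set (α → ℝ)} {Y : Set α} {d : ℕ}
    (hd : pseudoDim F Y = d) {S : Finset α} (hSY : (S : Set α) ⊆ Y) (hS : PseudoShatters F S) :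
    S.card ≤ d := by
  have h : (S.card : ℕ∞) ≤ pseudoDim F Y :=
    le_iSup₂ (f := fun (S : Finset α) (_ : (S : Set α) ⊆ Y ∧ PseudoShatters F S) => (S.card : ℕ∞))
      S ⟨hSY, hS⟩
  rw [hd] at h
  exact_mod_cast h

namespace LotteryMenu

variable {m ℓ : ℕ}

theorem profit'_of_choice_eq_zero (c : Finset (Fin m) → ℝ)
    {τ : LotteryMenu m ℓ → Equiv.Perm (Fin (ℓ + 1))} {M : LotteryMenu m ℓ} {v z : Fin m → ℝ}
    (h : M.choice τ v = 0) (hz : 0 ≤ z) : M.profit' c τ v z = -c ∅ := by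
  have : bundle (M.φ 0) z = ∅ := by
    ext i
    simpa [mem_bundle, φ] using hz i
  rw [profit', h, this]
  simp [p]

theorem pseudoShatters_profitClass_of_sub {b : BuyerType} {c : Finset (Fin m) → ℝ}
    {τ : LotteryMenu m ℓ → Equiv.Perm (Fin (ℓ + 1))} {S : Finset ((Fin m → ℝ) × (Fin m → ℝ))}
    (hS : PseudoShatters {g | ∃ (M : LotteryMenu m ℓ) (a : ℝ), M.Valid b ∧ 0 ≤ a ∧
      (a = 0 ∨ ∀ x ∈ S, M.choice τ x.1 ≠ 0) ∧ g = fun x => M.profit' c τ x.1 x.2 - a} S) :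
    PseudoShatters (profitClass b c τ) S := by
  refine PseudoShatters.of_tendsto ?_ hS
  rintro _ ⟨M, a, hM, ha, h0, rfl⟩
  exact ⟨fun k x => (M.shift (τ M) a k).profit' c τ x.1 x.2,
    fun k => ⟨_, hM.shift (τ M) a k, rfl⟩, fun x hx =>
    (isPerturbation_shift (τ M) a M).tendsto_profit' c ha (h0.imp_right fun h => h x hx) x.2⟩

/-- Normalizing the profit of each menu by a constant of its own does not increase the
pseudo-dimension, if these constants agree or if the menus are such that the seller's entries are
always chosen. -/
theorem pseudoShatters_profitClass_of_normalized {b : BuyerType} {c : Finset (Fin m) → ℝ}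
    {τ : LotteryMenu m ℓ → Equiv.Perm (Fin (ℓ + 1))} {ι : Type*} {M : ι → LotteryMenu m ℓ}
    (hM : ∀ i, (M i).Valid b) {A : ι → ℝ} {U : ℝ} (hU : 0 < U)
    {S : Finset ((Fin m → ℝ) × (Fin m → ℝ))}
    (hA : (∃ L, ∀ i, A i = L) ∨ ∀ i, ∀ x ∈ S, (M i).choice τ x.1 ≠ 0)
    (hS : PseudoShatters (Set.range fun i (x : (Fin m → ℝ) × (Fin m → ℝ)) =>
      ((M i).profit' c τ x.1 x.2 - A i + U) / (2 * U)) S) :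
    PseudoShatters (profitClass b c τ) S := by
  classical
  obtain ⟨r, hr⟩ := hS
  have hr2 : ∀ T, ∃ i, T ⊆ S → ∀ x ∈ S,
      (r x ≤ ((M i).profit' c τ x.1 x.2 - A i + U) / (2 * U) ↔ x ∈ T) := by
    intro T
    by_cases hT : T ⊆ S
    · obtain ⟨_, ⟨i, rfl⟩, hi⟩ := hr T hT
      exact ⟨i, fun _ => hi⟩
    · obtain ⟨_, ⟨i, rfl⟩, hi⟩ := hr ∅ (by simp)
      exact ⟨i, fun h => absurd h hT⟩
  choose i hi using hr2
  -- Prices may only be lowered, so the finitely many constants in use are compared with a common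
  -- lower bound `L`; the remaining shift by `L` is common to all patterns and goes into the
  -- thresholds.
  obtain ⟨L, hL⟩ : ∃ L, ∀ T ∈ S.powerset, 0 ≤ A (i T) - L ∧
      (A (i T) - L = 0 ∨ ∀ x ∈ S, (M (i T)).choice τ x.1 ≠ 0) := by
    rcases hA with ⟨L, hL⟩ | hA
    · exact ⟨L, fun T _ => by simp [hL]⟩
    · obtain ⟨L, hL⟩ := (S.powerset.image fun T => A (i T)).bddBelow
      exact ⟨L, fun T hT => ⟨sub_nonneg.2 (hL (Finset.mem_coe.2 (Finset.mem_image_of_mem _ hT))), Or.inr (hA _)⟩⟩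
  refine pseudoShatters_profitClass_of_sub ⟨fun x => 2 * U * r x - U + L, fun T hT => ?_⟩
  have hLT := hL T (Finset.mem_powerset.2 hT)
  refine ⟨_, ⟨M (i T), A (i T) - L, hM _, hLT.1, hLT.2, rfl⟩, fun x hx => ?_⟩
  rw [← hi T hT x hx, le_div_iff₀ (by positivity)]
  constructor <;> intro h <;> linarith

/-! ### Uniform convergence of the profit -/

/-- The map `y ↦ (y - A i + U) / (2 * U)` sends the profits into `[0,1]`; undoing it multiplies the
constant `132` by `2 * U`. -/
theorem measure_exists_profit'_deviation_le {b : BuyerType} (c : Finset (Fin m) → ℝ)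
    (τ : LotteryMenu m ℓ → Equiv.Perm (Fin (ℓ + 1)))
    (μ : Measure ((Fin m → ℝ) × (Fin m → ℝ))) [IsProbabilityMeasure μ]
    {Y : Set ((Fin m → ℝ) × (Fin m → ℝ))} (hY : ∀ᵐ x ∂μ, x ∈ Y)
    {ι : Type*} [Countable ι] {M : ι → LotteryMenu m ℓ}
    (hM : ∀ i, (M i).Valid b) {A : ι → ℝ} {U : ℝ} (hU : 0 < U)
    (hAU : ∀ i, ∀ x ∈ Y, |(M i).profit' c τ x.1 x.2 - A i| ≤ U)
    (hA : (∃ L, ∀ i, A i = L) ∨ ∀ i, ∀ x ∈ Y, (M i).choice τ x.1 ≠ 0)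
    {d : ℕ} (hd : 1 ≤ d) (hpd : pseudoDim (profitClass b c τ) Y = d)
    {N : ℕ} (hN : 1 ≤ N) {u : ℝ} (hu : 0 ≤ u) :
    Measure.pi (fun _ : Fin N => μ) {s | ∃ i, 264 * U * (√d + u) / √N <
      |(M i).empiricalProfit c τ s - ∫ x, (M i).profit' c τ x.1 x.2 ∂μ|}
      ≤ 2 * ENNReal.ofReal (Real.exp (-u ^ 2)) := by
  have hN' : (N : ℝ) ≠ 0 := by positivity
  have h := measure_exists_deviation_le μ
    (g := fun i (x : (Fin m → ℝ) × (Fin m → ℝ)) => ((M i).profit' c τ x.1 x.2 - A i + U) / (2 * U))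
    (fun i => (((measurable_profit' c τ (M i)).sub_const _).add_const _).div_const _) hY
    (fun i x hx => by
      have := abs_le.1 (hAU i x hx)
      refine ⟨div_nonneg (by linarith [this.1]) (by positivity), ?_⟩
      rw [div_le_one (by positivity)]
      linarith [this.2]) hd
    (fun S hSY hS => PseudoShatters.card_le_of_pseudoDim_eq hpd hSY
      (pseudoShatters_profitClass_of_normalized hM hU
        (hA.imp_right fun h i x hx => h i x (hSY hx)) hS)) hN hu
  refine (measure_mono ?_).trans h
  rintro s ⟨i, hi⟩
  refine ⟨i, ?_⟩
  have hint : ∫ x, ((M i).profit' c τ x.1 x.2 - A i + U) / (2 * U) ∂μ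
      = (∫ x, (M i).profit' c τ x.1 x.2 ∂μ - A i + U) / (2 * U) := by
    have hI := integrable_profit' c τ (M i) μ
    simp only [sub_add]
    rw [integral_div, integral_sub hI (integrable_const _)]
    simp
  have hemp : sampleMean (fun x : (Fin m → ℝ) × (Fin m → ℝ) =>
      ((M i).profit' c τ x.1 x.2 - A i + U) / (2 * U)) s
      = ((M i).empiricalProfit c τ s - A i + U) / (2 * U) := by
    simp only [sampleMean, empiricalProfit, ← Finset.sum_div, Finset.sum_add_distrib,
      Finset.sum_sub_distrib, Finset.sum_const, Finset.card_univ, Fintype.card_fin, nsmul_eq_mul]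
    field_simp
  rw [hint, hemp, ← sub_div, abs_div, abs_of_pos (by positivity : 0 < 2 * U), lt_div_iff₀ (by positivity)]
  calc 132 * (√d + u) / √N * (2 * U) = 264 * U * (√d + u) / √N := by ring
    _ < _ := hi
    _ = _ := by congr 1; ring

/-- Dominated convergence: the profits converge at one point `x₀`, hence are bounded there, and the
range bound `U` carries this to all of `Y` uniformly in `k`. -/
theorem tendsto_integral_profit' {b : BuyerType} {c : Finset (Fin m) → ℝ}
    {τ : LotteryMenu m ℓ → Equiv.Perm (Fin (ℓ + 1))}
    {μ : Measure ((Fin m → ℝ) × (Fin m → ℝ))} [IsProbabilityMeasure μ]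
    {Y : Set ((Fin m → ℝ) × (Fin m → ℝ))} (hY : ∀ᵐ x ∂μ, x ∈ Y) {U : ℝ}
    (hU : ∀ M : LotteryMenu m ℓ, M.Valid b → ∀ x ∈ Y, ∀ y ∈ Y,
      M.profit' c τ x.1 x.2 - M.profit' c τ y.1 y.2 ≤ U)
    {M : LotteryMenu m ℓ} {M' : ℕ → LotteryMenu m ℓ} (hM' : ∀ k, (M' k).Valid b)
    (h : IsPerturbation (τ M) 0 M M') :
    Tendsto (fun k => ∫ x, (M' k).profit' c τ x.1 x.2 ∂μ) atTop
      (𝓝 (∫ x, M.profit' c τ x.1 x.2 ∂μ)) := by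
  have hlim : ∀ x : (Fin m → ℝ) × (Fin m → ℝ), Tendsto (fun k => (M' k).profit' c τ x.1 x.2) atTop
      (𝓝 (M.profit' c τ x.1 x.2)) := fun x => by
    simpa using h.tendsto_profit' c le_rfl (Or.inl rfl) x.2
  obtain ⟨x₀, hx₀⟩ := hY.exists
  obtain ⟨B, hB⟩ := (Metric.isBounded_range_of_tendsto _ (hlim x₀)).exists_norm_le
  refine tendsto_integral_of_dominated_convergence (fun _ => B + U)
    (fun k => (measurable_profit' c τ (M' k)).aestronglyMeasurable) (integrable_const _)
    (fun k => ?_) (Eventually.of_forall hlim)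
  filter_upwards [hY] with x hx
  have h1 := hU _ (hM' k) x hx x₀ hx₀
  have h2 := hU _ (hM' k) x₀ hx₀ x hx
  have h3 := abs_le.1 (hB _ ⟨k, rfl⟩)
  exact abs_le.2 ⟨by linarith [h3.1], by linarith [h3.2]⟩

theorem tendsto_empiricalProfit {c : Finset (Fin m) → ℝ}
    {τ : LotteryMenu m ℓ → Equiv.Perm (Fin (ℓ + 1))}
    {M : LotteryMenu m ℓ} {M' : ℕ → LotteryMenu m ℓ}
    (h : IsPerturbation (τ M) 0 M M') {N : ℕ} (s : Fin N → (Fin m → ℝ) × (Fin m → ℝ)) :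
    Tendsto (fun k => (M' k).empiricalProfit c τ s) atTop (𝓝 (M.empiricalProfit c τ s)) := by
  refine (tendsto_finsetSum _ fun i _ => ?_).const_mul _
  simpa using h.tendsto_profit' c le_rfl (Or.inl rfl) (s i).2

/-- Uniform convergence over all menus, without normalization. -/
theorem measure_exists_valid_deviation_le {b : BuyerType} (c : Finset (Fin m) → ℝ)
    (τ : LotteryMenu m ℓ → Equiv.Perm (Fin (ℓ + 1)))
    (μ : Measure ((Fin m → ℝ) × (Fin m → ℝ))) [IsProbabilityMeasure μ]
    {Y : Set ((Fin m → ℝ) × (Fin m → ℝ))} (hY : ∀ᵐ x ∂μ, x ∈ Y) (hY0 : ∀ x ∈ Y, 0 ≤ x.2)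
    {U : ℝ} (hU0 : 0 < U)
    (hU : ∀ M : LotteryMenu m ℓ, M.Valid b → ∀ x ∈ Y, ∀ y ∈ Y,
      M.profit' c τ x.1 x.2 - M.profit' c τ y.1 y.2 ≤ U)
    {d : ℕ} (hd : 1 ≤ d) (hpd : pseudoDim (profitClass b c τ) Y = d)
    {N : ℕ} (hN : 1 ≤ N) {u : ℝ} (hu : 0 ≤ u) :
    Measure.pi (fun _ : Fin N => μ) {s | ∃ M : LotteryMenu m ℓ, M.Valid b ∧
      264 * U * (√d + u) / √N <
        |M.empiricalProfit c τ s - ∫ x, M.profit' c τ x.1 x.2 ∂μ|}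
      ≤ 4 * ENNReal.ofReal (Real.exp (-u ^ 2)) := by
  obtain ⟨x₀, hx₀⟩ := hY.exists
  have habs : ∀ M : LotteryMenu m ℓ, M.Valid b → ∀ x ∈ Y, ∀ y ∈ Y,
      |M.profit' c τ x.1 x.2 - M.profit' c τ y.1 y.2| ≤ U := fun M hM x hx y hy =>
    abs_le.2 ⟨by linarith [hU M hM y hy x hx], hU M hM x hx y hy⟩
  -- Menus with this property take the value `-c ∅` on `Y` and share it as centre; the others are
  -- centred at their own value at `x₀`. The two cases account for the factor `4`.
  let Zero : LotteryMenu m ℓ → Prop := fun M => ∃ x ∈ Y, M.choice τ x.1 = 0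
  have h0 := measure_exists_profit'_deviation_le c τ μ hY
    (ι := {q : (Fin ℓ → Fin m → ℚ) × (Fin ℓ → ℚ) //
      (ofRat q : LotteryMenu m ℓ).Valid b ∧ Zero (ofRat q)})
    (M := fun q => ofRat q.1) (fun q => q.2.1) (A := fun _ => -c ∅) hU0
    (fun q x hx => by
      obtain ⟨y, hy, hy0⟩ := q.2.2
      rw [← profit'_of_choice_eq_zero c hy0 (hY0 y hy)]
      exact habs _ q.2.1 x hx y hy) (Or.inl ⟨_, fun _ => rfl⟩) hd hpd hN hu
  have h1 := measure_exists_profit'_deviation_le c τ μ hY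
    (ι := {q : (Fin ℓ → Fin m → ℚ) × (Fin ℓ → ℚ) //
      (ofRat q : LotteryMenu m ℓ).Valid b ∧ ¬ Zero (ofRat q)})
    (M := fun q => ofRat q.1) (fun q => q.2.1)
    (A := fun q => (ofRat q.1 : LotteryMenu m ℓ).profit' c τ x₀.1 x₀.2) hU0
    (fun q x hx => habs _ q.2.1 x hx x₀ hx₀)
    (Or.inr fun q x hx hzero => q.2.2 ⟨x, hx, hzero⟩) hd hpd hN hu
  calc _ ≤ _ := measure_mono ?_
    _ ≤ _ := measure_union_le _ _
    _ ≤ _ := add_le_add h0 h1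
    _ = _ := by rw [← add_mul]; norm_num
  rintro s ⟨M, hM, hlt⟩
  by_contra hnot
  rw [Set.mem_union, not_or] at hnot
  obtain ⟨q, hq, hpert⟩ := hM.exists_isPerturbation_ofRat (τ M)
  -- Both the empirical and the expected profit of the rational approximants converge to those of
  -- `M`; a bound on all their deviations therefore passes to `M`.
  have hle : ∀ k, |(ofRat (q k) : LotteryMenu m ℓ).empiricalProfit c τ s -
      ∫ x, (ofRat (q k) : LotteryMenu m ℓ).profit' c τ x.1 x.2 ∂μ| ≤ 264 * U * (√d + u) / √N := by
    intro k
    by_contra hk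
    rw [not_le] at hk
    by_cases hz : Zero (ofRat (q k))
    · exact hnot.1 ⟨⟨q k, hq k, hz⟩, hk⟩
    · exact hnot.2 ⟨⟨q k, hq k, hz⟩, hk⟩
  exact absurd (le_of_tendsto' ((tendsto_empiricalProfit hpert s).sub
    (tendsto_integral_profit' hY hU hq hpert)).abs hle) (not_le.2 hlt)

/-- The menu all of whose lotteries give nothing and pay the buyer `P`. -/
def giveaway (m ℓ : ℕ) (P : ℝ) : LotteryMenu m ℓ where
  prob _ _ := 0
  price _ := -P

theorem giveaway_valid (b : BuyerType) (P : ℝ) : (giveaway m ℓ P).Valid b :=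
  ⟨by simp [giveaway], by simp [giveaway]⟩

theorem profit'_giveaway (c : Finset (Fin m) → ℝ)
    (τ : LotteryMenu m ℓ → Equiv.Perm (Fin (ℓ + 1))) (hℓ : ℓ ≠ 0) {P : ℝ} (hP : 0 < P)
    (v : Fin m → ℝ) {z : Fin m → ℝ} (hz : 0 ≤ z) :
    (giveaway m ℓ P).profit' c τ v z = -P - c ∅ := by
  have hφ : ∀ j, (giveaway m ℓ P).φ j = 0 := fun j => by
    refine Fin.cases rfl (fun j => ?_) j
    simp only [φ, giveaway, Fin.cons_succ]
    rfl
  have hb : bundle ((giveaway m ℓ P).φ ((giveaway m ℓ P).choice τ v)) z = ∅ := by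
    ext i
    simpa [mem_bundle, hφ] using hz i
  have hp : ∀ j, j ≠ 0 → (giveaway m ℓ P).p j = -P := fun j hj => by
    obtain ⟨j, rfl⟩ := Fin.exists_succ_eq.2 hj
    simp [p, giveaway]
  have hc : (giveaway m ℓ P).choice τ v ≠ 0 := by
    intro h
    have hne : (Fin.succ ⟨0, Nat.pos_of_ne_zero hℓ⟩ : Fin (ℓ + 1)) ≠ 0 := Fin.succ_ne_zero _
    have h1 := utility_le_choice τ (giveaway m ℓ P) v (Fin.succ ⟨0, Nat.pos_of_ne_zero hℓ⟩)
    rw [h] at h1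
    simp only [utility, hφ, hp _ hne] at h1
    simp [p] at h1
    linarith
  rw [profit', hb, hp _ hc]

/-- Only the class of menus without lotteries has pseudo-dimension `0`. -/
theorem eq_zero_of_pseudoDim_eq_zero {b : BuyerType} {c : Finset (Fin m) → ℝ}
    {τ : LotteryMenu m ℓ → Equiv.Perm (Fin (ℓ + 1))} {Y : Set ((Fin m → ℝ) × (Fin m → ℝ))}
    {x₀ : (Fin m → ℝ) × (Fin m → ℝ)} (hx₀ : x₀ ∈ Y) (hx₀' : 0 ≤ x₀.2)
    (hpd : pseudoDim (profitClass b c τ) Y = (0 : ℕ)) : ℓ = 0 := by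
  by_contra hℓ
  have hS : PseudoShatters (profitClass b c τ) {x₀} := by
    -- Paying out `1` meets this threshold exactly and paying out `2` falls below it, so a single
    -- point is shattered as soon as there is one lottery.
    refine ⟨fun _ => -1 - c ∅, fun T _ => ?_⟩
    by_cases hT : x₀ ∈ T
    · refine ⟨_, ⟨giveaway m ℓ 1, giveaway_valid b 1, rfl⟩, fun x hx => ?_⟩
      rw [Finset.mem_singleton.1 hx, profit'_giveaway c τ hℓ one_pos _ hx₀']
      simp [hT]
    · refine ⟨_, ⟨giveaway m ℓ 2, giveaway_valid b 2, rfl⟩, fun x hx => ?_⟩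
      rw [Finset.mem_singleton.1 hx, profit'_giveaway c τ hℓ two_pos _ hx₀']
      refine iff_of_false (fun h => ?_) hT
      linarith
  have := PseudoShatters.card_le_of_pseudoDim_eq hpd (by simpa using hx₀) hS
  simp at this

/-- If the profit of every menu is constant, the sample averages are exact. -/
theorem ae_empiricalProfit_eq_of_const {b : BuyerType} {c : Finset (Fin m) → ℝ}
    {τ : LotteryMenu m ℓ → Equiv.Perm (Fin (ℓ + 1))}
    {μ : Measure ((Fin m → ℝ) × (Fin m → ℝ))} [IsProbabilityMeasure μ]
    {Y : Set ((Fin m → ℝ) × (Fin m → ℝ))} (hY : ∀ᵐ x ∂μ, x ∈ Y)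
    (hconst : ∀ M : LotteryMenu m ℓ, M.Valid b → ∀ x ∈ Y, ∀ y ∈ Y,
      M.profit' c τ x.1 x.2 = M.profit' c τ y.1 y.2) {N : ℕ} (hN : 1 ≤ N) :
    ∀ᵐ s ∂Measure.pi (fun _ : Fin N => μ), ∀ M : LotteryMenu m ℓ, M.Valid b →
      M.empiricalProfit c τ s = ∫ x, M.profit' c τ x.1 x.2 ∂μ := by
  obtain ⟨x₀, hx₀⟩ := hY.exists
  have hN' : (N : ℝ) ≠ 0 := by positivity
  have hs : ∀ᵐ s ∂Measure.pi (fun _ : Fin N => μ), ∀ k, s k ∈ Y :=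
    ae_all_iff.2 fun k => (measurePreserving_eval (fun _ : Fin N => μ) k).quasiMeasurePreserving.ae hY
  filter_upwards [hs] with s hs M hM
  have h1 : ∫ x, M.profit' c τ x.1 x.2 ∂μ = M.profit' c τ x₀.1 x₀.2 := by
    rw [integral_congr_ae (hY.mono fun x hx => hconst M hM x hx x₀ hx₀)]
    simp
  rw [h1, empiricalProfit, Finset.sum_congr rfl fun k _ => hconst M hM (s k) (hs k) x₀ hx₀]
  simp
  field_simp

/-- Uniform convergence with the explicit constant `800`. -/
theorem measure_exists_valid_deviation_le_of_support (b : BuyerType) (c : Finset (Fin m) → ℝ)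
    (τ : LotteryMenu m ℓ → Equiv.Perm (Fin (ℓ + 1))) (D : Measure (Fin m → ℝ))
    [IsProbabilityMeasure D] {U : ℝ}
    (hU : ∀ M : LotteryMenu m ℓ, M.Valid b → ∀ x ∈ D.support ×ˢ Set.Icc (0 : Fin m → ℝ) 1,
      ∀ y ∈ D.support ×ˢ Set.Icc (0 : Fin m → ℝ) 1,
        M.profit' c τ x.1 x.2 - M.profit' c τ y.1 y.2 ≤ U)
    {d : ℕ} (hpd : pseudoDim (profitClass b c τ) (D.support ×ˢ Set.Icc (0 : Fin m → ℝ) 1) = d)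
    {N : ℕ} (hN : 1 ≤ N) {δ : ℝ} (hδ0 : 0 < δ) (hδ1 : δ < 1) :
    Measure.pi (fun _ : Fin N => D.prod (uniformCube m)) {s | ∃ M : LotteryMenu m ℓ, M.Valid b ∧
      800 * (U * √(d / N) + U * √(Real.log (1 / δ) / N)) <
        |M.empiricalProfit c τ s - ∫ x, M.profit' c τ x.1 x.2 ∂D.prod (uniformCube m)|}
      ≤ ENNReal.ofReal δ := by
  have hY : ∀ᵐ x ∂D.prod (uniformCube m), x ∈ D.support ×ˢ Set.Icc (0 : Fin m → ℝ) 1 := by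
    have h1 : ∀ᵐ v ∂D, v ∈ D.support := Measure.support_mem_ae
    exact (Measure.quasiMeasurePreserving_fst.ae h1).and
      (Measure.quasiMeasurePreserving_snd.ae (ae_uniformCube_mem_Icc m))
  have hY0 : ∀ x ∈ D.support ×ˢ Set.Icc (0 : Fin m → ℝ) 1, 0 ≤ x.2 := fun x hx => hx.2.1
  obtain ⟨x₀, hx₀⟩ := hY.exists
  have hU0 : 0 ≤ U := by
    simpa using hU (giveaway m ℓ 1) (giveaway_valid b 1) x₀ hx₀ x₀ hx₀
  -- If every profit is constant, the right-hand side may vanish, but then the deviations vanish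
  -- almost surely. Otherwise `U > 0`, and also `d ≥ 1`, since `d = 0` forces `ℓ = 0` and hence the
  -- constant profit `-c ∅`.
  by_cases hconst : ∀ M : LotteryMenu m ℓ, M.Valid b →
      ∀ x ∈ D.support ×ˢ Set.Icc (0 : Fin m → ℝ) 1, ∀ y ∈ D.support ×ˢ Set.Icc (0 : Fin m → ℝ) 1,
      M.profit' c τ x.1 x.2 = M.profit' c τ y.1 y.2
  · refine le_of_eq_of_le (measure_mono_null ?_ (ae_empiricalProfit_eq_of_const hY hconst hN))
      zero_le
    rintro s ⟨M, hM, hlt⟩ hs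
    rw [hs M hM, sub_self, abs_zero] at hlt
    exact absurd hlt (not_lt.2 (by positivity))
  · have hUpos : 0 < U := by
      refine hU0.lt_of_ne fun h => hconst fun M hM x hx y hy => ?_
      have h1 := hU M hM x hx y hy
      have h2 := hU M hM y hy x hx
      linarith
    have hd : 1 ≤ d := by
      by_contra hd
      obtain rfl : d = 0 := by omega
      obtain rfl := eq_zero_of_pseudoDim_eq_zero hx₀ (hY0 _ hx₀) hpd
      refine hconst fun M hM x hx y hy => ?_
      rw [profit'_of_choice_eq_zero c (Fin.fin_one_eq_zero _) (hY0 x hx),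
        profit'_of_choice_eq_zero c (Fin.fin_one_eq_zero _) (hY0 y hy)]
    have hlog : 0 ≤ Real.log (1 / δ) := Real.log_nonneg (one_le_one_div hδ0 hδ1.le)
    have hlog4 : Real.log (4 / δ) = Real.log 4 + Real.log (1 / δ) := by
      rw [← Real.log_mul (by norm_num) (by positivity), mul_one_div]
    have h4 : Real.log 4 ≤ 4 := (Real.log_le_sub_one_of_pos (by norm_num)).trans (by norm_num)
    have h4' : 0 ≤ Real.log 4 := Real.log_nonneg (by norm_num)
    -- This makes `4 * exp (-u ^ 2) = δ`. The extra `log 4` is absorbed into `2 * √d` because `d ≥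
    -- 1`, giving the constant `264 * 3 = 792 ≤ 800`.
    set u := √(Real.log (4 / δ)) with hu
    have h := measure_exists_valid_deviation_le c τ _ hY hY0 hUpos hU hd hpd hN
      (Real.sqrt_nonneg (Real.log (4 / δ)))
    rw [Real.sq_sqrt (by rw [hlog4]; positivity), Real.exp_neg, Real.exp_log (by positivity),
      inv_div, ENNReal.ofReal_div_of_pos (by norm_num)] at h
    have hfour : 4 * (ENNReal.ofReal δ / ENNReal.ofReal 4) = ENNReal.ofReal δ := by
      rw [show ENNReal.ofReal 4 = 4 by simp]
      exact ENNReal.mul_div_cancel (by simp) (by simp)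
    rw [hfour] at h
    refine (measure_mono ?_).trans h
    rintro s ⟨M, hM, hlt⟩
    refine ⟨M, hM, lt_of_le_of_lt ?_ hlt⟩
    have hd1 : 1 ≤ √(d : ℝ) := Real.one_le_sqrt.2 (by exact_mod_cast hd)
    have hsN : 0 < √(N : ℝ) := Real.sqrt_pos.2 (by exact_mod_cast hN)
    have hule : u ≤ 2 * √d + √(Real.log (1 / δ)) := by
      rw [hu, hlog4]
      apply Real.sqrt_le_iff.2
      refine ⟨by positivity, ?_⟩
      have := Real.sq_sqrt hlog
      nlinarith [Real.sqrt_nonneg (Real.log (1 / δ))]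
    rw [Real.sqrt_div (Nat.cast_nonneg d), Real.sqrt_div hlog]
    calc 264 * U * (√d + u) / √N ≤ 264 * U * (√d + (2 * √d + √(Real.log (1 / δ)))) / √N := by gcongr
      _ = U * ((792 * √d + 264 * √(Real.log (1 / δ))) / √N) := by ring
      _ ≤ U * ((800 * √d + 800 * √(Real.log (1 / δ))) / √N) := by
          gcongr <;> norm_num
      _ = _ := by ring

end LotteryMenu

end

theorem mainTheorem2 :
    -- the derandomized profit class is delineable
    (∀ (m ℓ : ℕ) (b : BuyerType) (c : Finset (Fin m) → ℝ)
        (τ : LotteryMenu m ℓ → Equiv.Perm (Fin (ℓ + 1))) (X : Set (Fin m → ℝ)),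
      IsDelineable (ℓ * (m + 1)) ((ℓ + 1) ^ 2 + m * ℓ)
        {x : Fin (ℓ * (m + 1)) → ℝ | (LotteryMenu.ofVector x : LotteryMenu m ℓ).Valid b}
        (fun x vz => (LotteryMenu.ofVector x : LotteryMenu m ℓ).profit' c τ vz.1 vz.2)
        (X ×ˢ Set.Icc (0 : Fin m → ℝ) 1)) ∧
    -- uniform convergence, with an absolute constant
    ∃ C : ℝ, 0 < C ∧
      ∀ (m ℓ : ℕ) (b : BuyerType) (c : Finset (Fin m) → ℝ)
        (τ : LotteryMenu m ℓ → Equiv.Perm (Fin (ℓ + 1)))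
        (D : MeasureTheory.Measure (Fin m → ℝ)) [MeasureTheory.IsProbabilityMeasure D] (U : ℝ)
        (_ : ∀ M : LotteryMenu m ℓ, M.Valid b →
          ∀ x ∈ D.support ×ˢ Set.Icc (0 : Fin m → ℝ) 1,
          ∀ y ∈ D.support ×ˢ Set.Icc (0 : Fin m → ℝ) 1,
            M.profit' c τ x.1 x.2 - M.profit' c τ y.1 y.2 ≤ U)
        (d : ℕ)
        (_ : pseudoDim (LotteryMenu.profitClass b c τ)
          (D.support ×ˢ Set.Icc (0 : Fin m → ℝ) 1) = d)
        (N : ℕ) (_ : 1 ≤ N) (δ : ℝ) (_ : 0 < δ) (_ : δ < 1),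
        (MeasureTheory.Measure.pi fun _ : Fin N => D.prod (uniformCube m))
          {s | ¬ ∀ M : LotteryMenu m ℓ, M.Valid b →
            |M.empiricalProfit c τ s - ∫ v, M.profit c τ v ∂D| ≤
                C * (U * Real.sqrt (d / N) + U * Real.sqrt (Real.log (1 / δ) / N)) ∧
            (b = BuyerType.unitDemand → AdditiveCost c →
              |M.empiricalProfit c τ s - ∫ v, M.singleItemProfit c τ v ∂D| ≤
                C * (U * Real.sqrt (d / N) + U * Real.sqrt (Real.log (1 / δ) / N)))}
          ≤ ENNReal.ofReal δ := by
  refine ⟨fun m ℓ b c τ X => LotteryMenu.isDelineable_profit' b c τ _, 800, by norm_num, ?_⟩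
  intro m ℓ b c τ D _ U hU d hpd N hN δ hδ0 hδ1
  -- The bad event is a union over uncountably many menus; it is only bounded in outer measure, by
  -- monotonicity, so its measurability is not needed.
  refine (measure_mono ?_).trans
    (LotteryMenu.measure_exists_valid_deviation_le_of_support b c τ D hU hpd hN hδ0 hδ1)
  intro s hs
  by_contra hnot
  refine hs fun M hM => ?_
  have h : |M.empiricalProfit c τ s - ∫ v, M.profit c τ v ∂D| ≤
      800 * (U * Real.sqrt (d / N) + U * Real.sqrt (Real.log (1 / δ) / N)) := by
    rw [← LotteryMenu.integral_profit' c τ hM]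
    exact not_lt.1 fun hlt => hnot ⟨M, hM, hlt⟩
  refine ⟨h, fun _ hc => ?_⟩
  simpa only [LotteryMenu.singleItemProfit_eq_profit hc] using h
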